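/- **Lower bound for approximate top-$K$ recovery.** *Sampling model.* There are $n$ items. A multinomial logit (MNL) model with weights $w_1,\dots,w_n>0$ has choice probabilities $\rho(i\mid S)=w_i/\sum_{k\in S}w_k$ for $i\in S\subseteq[n]$. In each of $R$ rounds, every menu $S\subseteq[n]$ of size $m$ is offered independently with probability $p\in[0,1]$; if $S$ is offered in round $r$, then $Y_S^r=i\in S$ with probability $\rho(i\mid S)$, and otherwise $Y_S^r$ records that $S$ was not offered. All $Y_S^r$ are mutually independent. *Notation.* Let $\tau_i^{(m)}=\binom{n-1}{m-1}^{-1}\sum_{S\ni i,\,|S|=m}\rho(i\mid S)$, let $\tau_{k}^{(m)}$ (as an order statistic) be the $k$-th largest of these $n$ numbers, and let $\Delta_{K,h}^{(m)}=\tau_{K-h}^{(m)}-\tau_{K+h+1}^{(m)}$. For sets $A,B$ of $K$ items let $D_{01}(A,B)=|A\setminus B|=|B\setminus A|$. For $0<\delta<v$ and $S^*\subseteq[n]$ with $|S^*|=K$, let $\mathcal M(v,\delta,S^*)$ be the MNL model with weight $v+\delta$ on $S^*$ and $v$ off $S^*$; its set of top $K$ items is $S^*$. For fixed $v,\delta$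 these models are relabelings of one another, so $\tau_{K-h}^{(m)}$ and $\Delta_{K,h}^{(m)}$ do not depend on $S^*$. *Theorem.* Let $n\ge 20$, $2\le m\le n$, let $K,h\ge 0$ be integers with $h<\tfrac23\min\{K,\sqrt n,n-K\}$, and let $0<\delta<v$. If $p\in[0,1]$ and the number of rounds $R\ge0$ satisfy $$pR\binom nm\le\frac1{96}\cdot\frac{n\log n}{m\,\Delta_{K,h}^{(m)}}\cdot\frac{\tau_{K-h}^{(m)}}{\Delta_{K,h}^{(m)}}$$ for the models $\mathcal M(v,\delta,\cdot)$, then for every (possibly randomized) estimator $\hat S_K$ that maps the data $(Y_S^r)$ to a set of $K$ items there is a set $S^*$ of $K$ items such that, when the data are generated by $\mathcal M(v,\delta,S^*)$, $$\Pr\big(D_{01}(\hat S_K,S^*)>h\big)\ge\frac15 .$$ -/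

import Mathlib

namespace TopKChoice

noncomputable section

/-- A choice rule on the items `Fin n`: `ρ i S` is the probability that item `i` is chosen when
the menu `S` is offered. -/
abbrev ChoiceRule (n : ℕ) : Type := Fin n → Finset (Fin n) → ℝ

/-- A multinomial logit (MNL) model on `n` items, given by its positive weights
(the exponentials of the utilities). -/
structure MNL (n : ℕ) where
  weight : Fin n → ℝ
  weight_pos : ∀ i, 0 < weight i

/-- The MNL choice rule `ρ(i | S) = w i / ∑ k ∈ S, w k` for `i ∈ S`
(and `0` for an item that is not on the menu). -/
def MNL.choice {n : ℕ} (M : MNL n) : ChoiceRule n := fun i S =>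
  if i ∈ S then M.weight i / ∑ k ∈ S, M.weight k else 0

/-- A set of exactly `K` items. -/
abbrev KSubset (n K : ℕ) : Type := {S : Finset (Fin n) // S.card = K}

/-- `S` is the set of the top `K` items of the model `M`: every item of `S` is strictly better
than every item outside `S`. -/
def MNL.IsTop {n K : ℕ} (M : MNL n) (S : KSubset n K) : Prop :=
  ∀ i ∈ S.1, ∀ j ∉ S.1, M.weight j < M.weight i

/-- The MNL model with parameters `(v, δ, S)`: weight `v + δ` on `S` and weight `v` off `S`. -/
def twoLevel {n K : ℕ} (v δ : ℝ) (hδ : 0 < δ) (hδv : δ < v) (S : KSubset n K) : MNL n where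
  weight i := if i ∈ S.1 then v + δ else v
  weight_pos i := by split_ifs <;> linarith

/-- The generalized Borda score `τ_i^{(m)}`: the average of `ρ(i | S)` over all menus `S` of
size `m` that contain `i`. -/
def bordaScore {n : ℕ} (ρ : ChoiceRule n) (m : ℕ) (i : Fin n) : ℝ :=
  (∑ S ∈ (Finset.univ : Finset (Finset (Fin n))) with S.card = m ∧ i ∈ S, ρ i S) /
    ((n - 1).choose (m - 1) : ℝ)

/-- The `k`-th largest value of `f`, counted with multiplicity (`1 ≤ k ≤ n`): the largest real
`t` such that at least `k` indices `i` satisfy `t ≤ f i`. -/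
def kthLargest {n : ℕ} (f : Fin n → ℝ) (k : ℕ) : ℝ :=
  sSup {t : ℝ | k ≤ (Finset.univ.filter fun i => t ≤ f i).card}

/-- `τ_{k}^{(m)}`: the `k`-th largest generalized Borda score. -/
def tau {n : ℕ} (ρ : ChoiceRule n) (m k : ℕ) : ℝ := kthLargest (bordaScore ρ m) k

/-- `Δ_{K,h}^{(m)} = τ_{K-h}^{(m)} - τ_{K+h+1}^{(m)}`. -/
def gap {n : ℕ} (ρ : ChoiceRule n) (m K h : ℕ) : ℝ := tau ρ m (K - h) - tau ρ m (K + h + 1)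

/-- A menu of size `m`. -/
abbrev Menu (n m : ℕ) : Type := {S : Finset (Fin n) // S.card = m}

/-- The observed choice data: for every round and every menu of size `m`, the chosen item, or
`none` if the menu was not offered in that round. -/
abbrev Data (n m R : ℕ) : Type := Fin R → Menu n m → Option (Fin n)

/-- The law of a single observation: the menu `S` is offered with probability `p`, and if it is
offered an item is chosen according to `ρ(· | S)`. -/
def obsProb {n : ℕ} (ρ : ChoiceRule n) (p : ℝ) (S : Finset (Fin n)) : Option (Fin n) → ℝ
  | none => 1 - p
  | some i => p * ρ i S

/-- The likelihood of the data: the observations for the different rounds and menus are mutually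
independent. -/
def likelihood {n m R : ℕ} (ρ : ChoiceRule n) (p : ℝ) (Y : Data n m R) : ℝ :=
  ∏ r : Fin R, ∏ S : Menu n m, obsProb ρ p S.1 (Y r S)

/-- The edit distance of two sets of the same size `K`: the number of elements of one that are
missing from the other. -/
def editDist {n K : ℕ} (A B : KSubset n K) : ℕ := (A.1 \ B.1).card

/-- A (possibly randomized) estimator of the set of the top `K` items: it maps the data to a
probability vector on the sets of `K` items, from which the estimate is drawn. -/
abbrev Estimator (n m R K : ℕ) : Type := Data n m R → stdSimplex ℝ (KSubset n K)

/-- The probability that the estimate is at edit distance more than `h` from `S`, when the data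
are generated by the choice rule `ρ`. -/
def errorProb {n m R K : ℕ} (ρ : ChoiceRule n) (p : ℝ) (est : Estimator n m R K) (h : ℕ)
    (S : KSubset n K) : ℝ :=
  ∑ Y : Data n m R, likelihood ρ p Y *
    ∑ T : KSubset n K with h < editDist T S, (est Y).1 T

end

end TopKChoice

/-!
The proof is an application of Fano's inequality to a family of two-level models with a common
reference model.

*The family.* Let `k` be the size of the smaller one of the top set and its complement. Fix a set
`G` of `n - k + q` items and let `A` range over its `q`-subsets. If `2K ≤ n` the top set is
`Gᶜ ∪ A` and the reference model has top set `Gᶜ`, so that the items of `A` are raised; otherwise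
the top set is `G \ A` and the reference model has top set `G`, so that the items of `A` are
lowered. By passing to complements (`exists_core_of_card_eq`), in both cases an edit distance ball
of radius `h` around any set corresponds to at most the sets `A` that miss at most `h` elements of
one fixed `q`-subset of `G`. With `l = q - h`, a union bound shows that they form at most a
fraction `C(q, l)² / C(N, l)` of the family, `N = n - k + q`.

*The divergences.* On a menu with `α` items of `A` the divergence of the choice from its reference
law is at most `α` times the inverse total weight of the menu times an explicit function of
`δ / v` (`menuDiv_raise_le`, `menuDiv_lower_le`). Summed over the menus, the inverse weights give
back the generalized Borda scores, which take one value on the top set and one off it. Exchanging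
a top item with another one menu by menu bounds the gap from below by a multiple of the score of a
top item (`bordaScore_gap`). The hypothesis on `p R C(n, m)` then bounds the divergence of the data
laws by `q log n / 40` (`mul_divBound_le`).

*The comparison.* Fano's inequality is used in the variational form `exists_success_le`: under the
reference law no estimator is close to more than a fraction `r` of the family, and a divergence `I`
with `I + log (1 + (B - 1) r) ≤ (4 / 5) log B` for some `B > 1` keeps the success probability of
some member at most `4 / 5`. Mostly `B = 4 / r` serves, and the condition becomes
`(4 / r) ^ (4 / 5) ≥ 5 n ^ (q / 40)`. The size `q` is free between `3h / 2` and `k`; it is chosen in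
`exists_defeats`. For large `h` the condition follows from elementary bounds for binomial
coefficients; for each small `h` it is checked at the least admissible `n` and propagated upwards
by `Separated.mono`.
-/

/-! ### A variational form of Fano's inequality -/

/-- The Gibbs variational inequality: an expectation is at most the logarithm of the exponential
moment. -/
lemma sum_mul_le_log_sum_mul_exp {ι : Type*} (s : Finset ι) (w g : ι → ℝ)
    (hw : ∀ i ∈ s, 0 ≤ w i) (hw1 : ∑ i ∈ s, w i = 1) :
    ∑ i ∈ s, w i * g i ≤ Real.log (∑ i ∈ s, w i * Real.exp (g i)) := by
  set Z := ∑ i ∈ s, w i * Real.exp (g i) with hZ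
  have hZpos : 0 < Z := by
    have hne : ∃ i ∈ s, w i ≠ 0 := by
      by_contra! h
      rw [Finset.sum_eq_zero h] at hw1
      exact zero_ne_one hw1
    obtain ⟨i, hi, hwi⟩ := hne
    exact Finset.sum_pos' (fun j hj => mul_nonneg (hw j hj) (Real.exp_pos _).le)
      ⟨i, hi, mul_pos (lt_of_le_of_ne (hw i hi) (Ne.symm hwi)) (Real.exp_pos _)⟩
  have key : ∀ i ∈ s, w i * g i - w i * Real.log Z ≤ w i * Real.exp (g i) / Z - w i := by
    intro i hi
    have h1 := Real.add_one_le_exp (g i - Real.log Z)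
    rw [Real.exp_sub, Real.exp_log hZpos] at h1
    have h2 := mul_le_mul_of_nonneg_left h1 (hw i hi)
    have h3 : w i * (Real.exp (g i) / Z) = w i * Real.exp (g i) / Z := by ring
    linarith
  have h := Finset.sum_le_sum key
  rw [Finset.sum_sub_distrib, Finset.sum_sub_distrib, ← Finset.sum_mul, ← Finset.sum_div, ← hZ,
    hw1, div_self hZpos.ne'] at h
  linarith

/-- Fano's inequality in variational form. The laws `P a` have log-likelihood ratios `ℓ a` with
respect to one reference law `Q`, with divergences at most `I`. If, whatever is observed, the
success indicators `f a` average to at most `r` over the family, then some `a` succeeds with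
probability at most `4 / 5`. The parameter `B` is the exponential tilt of the variational formula.
-/
lemma exists_success_le {Ω ι : Type*} [Fintype Ω] (s : Finset ι) (hs : s.Nonempty)
    (P : ι → Ω → ℝ) (Q : Ω → ℝ) (ℓ f : ι → Ω → ℝ)
    (hP : ∀ a ∈ s, ∀ y, P a y = Q y * Real.exp (ℓ a y)) (hQ : ∀ y, 0 ≤ Q y)
    (hP1 : ∀ a ∈ s, ∑ y, P a y = 1) (hQ1 : ∑ y, Q y = 1)
    (hf0 : ∀ a ∈ s, ∀ y, 0 ≤ f a y) (hf1 : ∀ a ∈ s, ∀ y, f a y ≤ 1)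
    {I r B : ℝ} (hI : ∀ a ∈ s, ∑ y, P a y * ℓ a y ≤ I)
    (hr : ∀ y, ∑ a ∈ s, f a y ≤ r * s.card) (hB : 1 < B)
    (hmain : I + Real.log (1 + (B - 1) * r) ≤ 4 / 5 * Real.log B) :
    ∃ a ∈ s, ∑ y, P a y * f a y ≤ 4 / 5 := by
  by_contra! hcon
  have hM : (0 : ℝ) < s.card := by exact_mod_cast hs.card_pos
  have hlogB : 0 < Real.log B := Real.log_pos hB
  have hP0 : ∀ a ∈ s, ∀ y, 0 ≤ P a y := fun a ha y => by
    rw [hP a ha y]; exact mul_nonneg (hQ y) (Real.exp_pos _).le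
  have hg := sum_mul_le_log_sum_mul_exp (s ×ˢ (Finset.univ : Finset Ω))
    (fun z => P z.1 z.2 / s.card) (fun z => Real.log B * f z.1 z.2 - ℓ z.1 z.2)
    (fun z hz => div_nonneg (hP0 z.1 (Finset.mem_product.1 hz).1 z.2) hM.le) (by
      rw [Finset.sum_product]
      simp only [← Finset.sum_div]
      rw [Finset.sum_congr rfl hP1]
      simp [hM.ne'])
  -- Convexity of the exponential bounds the tilted moment under the reference law.
  have hexp : ∑ z ∈ s ×ˢ (Finset.univ : Finset Ω), P z.1 z.2 / s.card *
      Real.exp (Real.log B * f z.1 z.2 - ℓ z.1 z.2) ≤ 1 + (B - 1) * r := by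
    have hpt : ∀ z ∈ s ×ˢ (Finset.univ : Finset Ω), P z.1 z.2 / s.card *
        Real.exp (Real.log B * f z.1 z.2 - ℓ z.1 z.2) ≤
        Q z.2 * (1 + (B - 1) * f z.1 z.2) / s.card := by
      intro z hz
      have ha := (Finset.mem_product.1 hz).1
      have hc := convexOn_exp.2 (Set.mem_univ (0 : ℝ)) (Set.mem_univ (Real.log B))
        (sub_nonneg.2 (hf1 z.1 ha z.2)) (hf0 z.1 ha z.2) (by ring)
      simp only [smul_eq_mul, mul_zero, zero_add, Real.exp_zero, mul_one,
        Real.exp_log (zero_lt_one.trans hB)] at hc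
      rw [mul_comm (Real.log B), Real.exp_sub, hP z.1 ha z.2, div_mul_eq_mul_div]
      refine div_le_div_of_nonneg_right ?_ hM.le
      have he := (Real.exp_pos (ℓ z.1 z.2)).ne'
      calc _ = Q z.2 * Real.exp (f z.1 z.2 * Real.log B) := by field_simp
        _ ≤ _ := mul_le_mul_of_nonneg_left (hc.trans (by linarith)) (hQ _)
    refine (Finset.sum_le_sum hpt).trans ?_
    rw [← Finset.sum_div, Finset.sum_product_right, div_le_iff₀ hM]
    have hy : ∀ y ∈ (Finset.univ : Finset Ω), ∑ a ∈ s, Q y * (1 + (B - 1) * f a y) ≤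
        Q y * ((1 + (B - 1) * r) * s.card) := by
      intro y _
      rw [← Finset.mul_sum]
      refine mul_le_mul_of_nonneg_left ?_ (hQ y)
      rw [Finset.sum_add_distrib, ← Finset.mul_sum]
      simp only [Finset.sum_const, nsmul_eq_mul, mul_one]
      nlinarith [hr y]
    refine (Finset.sum_le_sum hy).trans (le_of_eq ?_)
    rw [← Finset.sum_mul, hQ1, one_mul]
  have hpos : 0 < ∑ z ∈ s ×ˢ (Finset.univ : Finset Ω), P z.1 z.2 / s.card *
      Real.exp (Real.log B * f z.1 z.2 - ℓ z.1 z.2) := by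
    have hne : ∃ z ∈ s ×ˢ (Finset.univ : Finset Ω), P z.1 z.2 ≠ 0 := by
      by_contra! h
      obtain ⟨a, ha⟩ := hs
      have h1 := hP1 a ha
      rw [Finset.sum_eq_zero fun y _ => h (a, y) (by simp [ha])] at h1
      exact zero_ne_one h1
    obtain ⟨z, hz, hne⟩ := hne
    refine Finset.sum_pos' (fun z hz => mul_nonneg (div_nonneg
      (hP0 z.1 (Finset.mem_product.1 hz).1 z.2) hM.le) (Real.exp_pos _).le) ⟨z, hz, ?_⟩
    exact mul_pos (div_pos (lt_of_le_of_ne (hP0 z.1 (Finset.mem_product.1 hz).1 z.2)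
      (Ne.symm hne)) hM) (Real.exp_pos _)
  have hle := hg.trans ((Real.log_le_log hpos hexp))
  have hlow : 4 / 5 * Real.log B - I < ∑ z ∈ s ×ˢ (Finset.univ : Finset Ω),
      P z.1 z.2 / s.card * (Real.log B * f z.1 z.2 - ℓ z.1 z.2) := by
    rw [Finset.sum_product]
    have h1 : ∀ a ∈ s, (4 / 5 * Real.log B - I) / s.card <
        ∑ y, P a y / s.card * (Real.log B * f a y - ℓ a y) := by
      intro a ha
      have h2 : ∑ y, P a y / s.card * (Real.log B * f a y - ℓ a y) =
          (Real.log B * ∑ y, P a y * f a y - ∑ y, P a y * ℓ a y) / s.card := by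
        rw [Finset.mul_sum, ← Finset.sum_sub_distrib, Finset.sum_div]
        exact Finset.sum_congr rfl fun y _ => by ring
      rw [h2]
      refine div_lt_div_of_pos_right ?_ hM
      nlinarith [hcon a ha, hI a ha]
    refine lt_of_eq_of_lt ?_ (Finset.sum_lt_sum_of_nonempty hs h1)
    simp only [Finset.sum_const, nsmul_eq_mul]
    field_simp
  linarith

/-! ### Product laws on the data -/

/-- Under a product law, a function of one coordinate has the expectation it has under the law of
that coordinate. -/
lemma sum_prod_mul_apply {ι κ : Type*} [Fintype ι] [DecidableEq ι] [Fintype κ]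
    (P : ι → κ → ℝ) (hP : ∀ i, ∑ o, P i o = 1) (i₀ : ι) (g : κ → ℝ) :
    ∑ Y : ι → κ, (∏ i, P i (Y i)) * g (Y i₀) = ∑ o, P i₀ o * g o := by
  have h1 : ∀ Y : ι → κ, (∏ i, P i (Y i)) * g (Y i₀) =
      ∏ i, P i (Y i) * (if i = i₀ then g (Y i) else 1) := by
    intro Y
    rw [Finset.prod_mul_distrib, Fintype.prod_ite_eq' i₀ fun i => g (Y i)]
  simp only [h1]
  rw [← Fintype.prod_sum fun i o => P i o * (if i = i₀ then g o else 1)]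
  rw [Finset.prod_eq_single i₀]
  · simp
  · intro i _ hi
    simp [hi, hP i]
  · simp

lemma sum_prod_eq_one {ι κ : Type*} [Fintype ι] [DecidableEq ι] [Fintype κ]
    (P : ι → κ → ℝ) (hP : ∀ i, ∑ o, P i o = 1) : ∑ Y : ι → κ, ∏ i, P i (Y i) = 1 := by
  rw [← Fintype.prod_sum fun i o => P i o]
  simp [hP]

/-- The expectation of a sum of functions of the coordinates under a product law. -/
lemma sum_prod_mul_sum {ι κ : Type*} [Fintype ι] [DecidableEq ι] [Fintype κ]
    (P : ι → κ → ℝ) (hP : ∀ i, ∑ o, P i o = 1) (g : ι → κ → ℝ) :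
    ∑ Y : ι → κ, (∏ i, P i (Y i)) * ∑ i, g i (Y i) = ∑ i, ∑ o, P i o * g i o := by
  simp only [Finset.mul_sum]
  rw [Finset.sum_comm]
  exact Finset.sum_congr rfl fun i _ => sum_prod_mul_apply P hP i (g i)

namespace TopKChoice

lemma MNL.weight_sum_pos {n : ℕ} (M : MNL n) {U : Finset (Fin n)} (hU : U.Nonempty) :
    0 < ∑ k ∈ U, M.weight k :=
  Finset.sum_pos (fun k _ => M.weight_pos k) hU

lemma MNL.choice_nonneg {n : ℕ} (M : MNL n) (i : Fin n) (U : Finset (Fin n)) :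
    0 ≤ M.choice i U := by
  unfold MNL.choice
  split_ifs
  · exact div_nonneg (M.weight_pos i).le (Finset.sum_nonneg fun k _ => (M.weight_pos k).le)
  · exact le_rfl

lemma MNL.sum_choice {n : ℕ} (M : MNL n) {U : Finset (Fin n)} (hU : U.Nonempty) :
    ∑ i, M.choice i U = 1 := by
  unfold MNL.choice
  rw [Finset.sum_ite_mem, Finset.univ_inter, ← Finset.sum_div,
    div_self (M.weight_sum_pos hU).ne']

/-- The log-likelihood ratio of two MNL models at a single observation. It vanishes when the menu
is not offered; at the impossible choices of items off the menu its value is immaterial. -/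
noncomputable def logRatio {n : ℕ} (M M₀ : MNL n) (U : Finset (Fin n)) : Option (Fin n) → ℝ
  | none => 0
  | some i => Real.log (M.choice i U / M₀.choice i U)

/-- The Kullback–Leibler divergence of the choice from the menu `U` under `M` from that under
`M₀`. -/
noncomputable def menuDiv {n : ℕ} (M M₀ : MNL n) (U : Finset (Fin n)) : ℝ :=
  ∑ i, M.choice i U * Real.log (M.choice i U / M₀.choice i U)

lemma obsProb_eq_mul_exp {n : ℕ} (M M₀ : MNL n) (p : ℝ) (U : Finset (Fin n))
    (o : Option (Fin n)) :
    obsProb M.choice p U o = obsProb M₀.choice p U o * Real.exp (logRatio M M₀ U o) := by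
  cases o with
  | none => simp [obsProb, logRatio]
  | some i =>
    simp only [obsProb, logRatio]
    by_cases hi : i ∈ U
    · have h1 := div_pos (M.weight_pos i) (M.weight_sum_pos ⟨i, hi⟩)
      have h2 := div_pos (M₀.weight_pos i) (M₀.weight_sum_pos ⟨i, hi⟩)
      simp only [MNL.choice, hi, if_true]
      rw [Real.exp_log (div_pos h1 h2), mul_assoc, mul_div_cancel₀ _ h2.ne']
    · simp [MNL.choice, hi]

lemma obsProb_nonneg {n : ℕ} (M : MNL n) {p : ℝ} (hp0 : 0 ≤ p) (hp1 : p ≤ 1)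
    (U : Finset (Fin n)) (o : Option (Fin n)) : 0 ≤ obsProb M.choice p U o := by
  cases o with
  | none => simp only [obsProb]; linarith
  | some i => exact mul_nonneg hp0 (M.choice_nonneg i U)

lemma sum_obsProb {n : ℕ} (M : MNL n) (p : ℝ) {U : Finset (Fin n)} (hU : U.Nonempty) :
    ∑ o, obsProb M.choice p U o = 1 := by
  rw [Fintype.sum_option]
  simp only [obsProb]
  rw [← Finset.mul_sum, M.sum_choice hU]
  ring

lemma sum_likelihood {n m R : ℕ} (M : MNL n) (p : ℝ) (hm : 1 ≤ m) :
    ∑ Y : Data n m R, likelihood M.choice p Y = 1 := by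
  have hU : ∀ U : Menu n m, U.1.Nonempty := fun U => Finset.card_pos.1 (by rw [U.2]; omega)
  exact sum_prod_eq_one (fun (_ : Fin R) (y : Menu n m → Option (Fin n)) =>
    ∏ U : Menu n m, obsProb M.choice p U.1 (y U)) fun _ =>
      sum_prod_eq_one (fun (U : Menu n m) o => obsProb M.choice p U.1 o)
        fun U => sum_obsProb M p (hU U)

/-- The divergence of the data laws of two MNL models is the expected number of offers times the
divergences of the single choices. -/
lemma sum_likelihood_mul_logRatio {n m R : ℕ} (M M₀ : MNL n) (p : ℝ) (hm : 1 ≤ m) :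
    ∑ Y : Data n m R, likelihood M.choice p Y * ∑ r, ∑ U : Menu n m, logRatio M M₀ U.1 (Y r U) =
      p * R * ∑ U : Menu n m, menuDiv M M₀ U.1 := by
  have hU : ∀ U : Menu n m, U.1.Nonempty := fun U => Finset.card_pos.1 (by rw [U.2]; omega)
  have h1 := sum_prod_mul_sum (fun (_ : Fin R) (y : Menu n m → Option (Fin n)) =>
    ∏ U : Menu n m, obsProb M.choice p U.1 (y U)) (fun _ =>
      sum_prod_eq_one (fun (U : Menu n m) o => obsProb M.choice p U.1 o)
        fun U => sum_obsProb M p (hU U))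
    (fun _ y => ∑ U : Menu n m, logRatio M M₀ U.1 (y U))
  have h2 := sum_prod_mul_sum (fun (U : Menu n m) o => obsProb M.choice p U.1 o)
    (fun U => sum_obsProb M p (hU U)) (fun U o => logRatio M M₀ U.1 o)
  unfold likelihood
  rw [h1]
  simp only [h2, Finset.sum_const, Finset.card_univ, Fintype.card_fin, nsmul_eq_mul]
  have h3 : ∀ U : Menu n m, ∑ o, obsProb M.choice p U.1 o * logRatio M M₀ U.1 o =
      p * menuDiv M M₀ U.1 := by
    intro U
    rw [Fintype.sum_option, menuDiv, Finset.mul_sum]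
    simp [obsProb, logRatio, mul_assoc]
  simp only [h3]
  rw [← Finset.mul_sum]
  ring

/-- The probability that the estimate is within edit distance `h` of `S`, given the data `Y`. -/
noncomputable def hitProb {n m R K : ℕ} (est : Estimator n m R K) (h : ℕ) (S : KSubset n K)
    (Y : Data n m R) : ℝ :=
  ∑ T : KSubset n K with editDist T S ≤ h, (est Y).1 T

lemma hitProb_nonneg {n m R K : ℕ} (est : Estimator n m R K) (h : ℕ) (S : KSubset n K)
    (Y : Data n m R) : 0 ≤ hitProb est h S Y :=
  Finset.sum_nonneg fun T _ => (est Y).2.1 T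

lemma hitProb_add {n m R K : ℕ} (est : Estimator n m R K) (h : ℕ) (S : KSubset n K)
    (Y : Data n m R) :
    hitProb est h S Y + ∑ T : KSubset n K with h < editDist T S, (est Y).1 T = 1 := by
  rw [hitProb, ← (est Y).2.2]
  simp only [← not_le]
  exact Finset.sum_filter_add_sum_filter_not _ _ _

lemma hitProb_le_one {n m R K : ℕ} (est : Estimator n m R K) (h : ℕ) (S : KSubset n K)
    (Y : Data n m R) : hitProb est h S Y ≤ 1 := by
  have h1 := hitProb_add est h S Y
  have h2 : 0 ≤ ∑ T : KSubset n K with h < editDist T S, (est Y).1 T :=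
    Finset.sum_nonneg fun T _ => (est Y).2.1 T
  linarith

lemma errorProb_eq {n m R K : ℕ} (M : MNL n) (p : ℝ) (hm : 1 ≤ m) (est : Estimator n m R K)
    (h : ℕ) (S : KSubset n K) :
    errorProb M.choice p est h S =
      1 - ∑ Y : Data n m R, likelihood M.choice p Y * hitProb est h S Y := by
  rw [← sum_likelihood (R := R) M p hm, ← Finset.sum_sub_distrib, errorProb]
  refine Finset.sum_congr rfl fun Y _ => ?_
  have := hitProb_add est h S Y
  rw [← mul_one_sub]
  congr 1
  linarith

/-- Fano's inequality for the choice data. If every ball of radius `h` in the edit distance holds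
at most a fraction `r` of the family `S`, then no estimator is within `h` with probability above
`4 / 5` throughout the family. -/
lemma exists_errorProb_ge {n m R K : ℕ} {ι : Type*} (s : Finset ι) (hs : s.Nonempty)
    (hm : 1 ≤ m) {p : ℝ} (hp0 : 0 ≤ p) (hp1 : p ≤ 1) (est : Estimator n m R K) (h : ℕ)
    (S : ι → KSubset n K) (M : ι → MNL n) (M₀ : MNL n) {I r B : ℝ}
    (hI : ∀ a ∈ s, p * R * ∑ U : Menu n m, menuDiv (M a) M₀ U.1 ≤ I)
    (hr : ∀ T : KSubset n K, ((s.filter fun a => editDist T (S a) ≤ h).card : ℝ) ≤ r * s.card)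
    (hB : 1 < B) (hmain : I + Real.log (1 + (B - 1) * r) ≤ 4 / 5 * Real.log B) :
    ∃ a ∈ s, 1 / 5 ≤ errorProb (M a).choice p est h (S a) := by
  obtain ⟨a, ha, hle⟩ := exists_success_le s hs
    (fun a (Y : Data n m R) => likelihood (M a).choice p Y)
    (fun Y => likelihood M₀.choice p Y)
    (fun a Y => ∑ r, ∑ U : Menu n m, logRatio (M a) M₀ U.1 (Y r U))
    (fun a Y => hitProb est h (S a) Y)
    (fun a _ Y => by
      simp only [likelihood, Real.exp_sum, ← Finset.prod_mul_distrib]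
      refine Finset.prod_congr rfl fun r _ => Finset.prod_congr rfl fun U _ => ?_
      exact obsProb_eq_mul_exp _ _ _ _ _)
    (fun Y => Finset.prod_nonneg fun r _ => Finset.prod_nonneg fun U _ =>
      obsProb_nonneg M₀ hp0 hp1 _ _)
    (fun a _ => sum_likelihood (M a) p hm) (sum_likelihood M₀ p hm)
    (fun a _ Y => hitProb_nonneg est h (S a) Y) (fun a _ Y => hitProb_le_one est h (S a) Y)
    (I := I) (r := r) (B := B)
    (fun a ha => by rw [sum_likelihood_mul_logRatio _ _ _ hm]; exact hI a ha)
    (fun Y => by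
      have h1 : ∑ a ∈ s, hitProb est h (S a) Y = ∑ T : KSubset n K, (est Y).1 T *
          ((s.filter fun a => editDist T (S a) ≤ h).card : ℝ) := by
        simp only [hitProb, Finset.sum_filter]
        rw [Finset.sum_comm]
        refine Finset.sum_congr rfl fun T _ => ?_
        rw [← Finset.sum_filter, Finset.sum_const, nsmul_eq_mul, mul_comm]
      rw [h1]
      refine (Finset.sum_le_sum fun T _ =>
        mul_le_mul_of_nonneg_left (hr T) ((est Y).2.1 T)).trans (le_of_eq ?_)
      rw [← Finset.sum_mul, (est Y).2.2, one_mul])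
    hB hmain
  refine ⟨a, ha, ?_⟩
  rw [errorProb_eq _ _ hm]
  linarith

end TopKChoice

namespace TopKChoice

/-! ### Borda scores of the two-level models -/

/-- The sum of the inverse total weights of the menus of size `m` that contain `i`. -/
noncomputable def invSum {n : ℕ} (M : MNL n) (m : ℕ) (i : Fin n) : ℝ :=
  ∑ U : Finset (Fin n) with U.card = m ∧ i ∈ U, 1 / ∑ k ∈ U, M.weight k

lemma bordaScore_eq {n : ℕ} (M : MNL n) (m : ℕ) (i : Fin n) :
    bordaScore M.choice m i = M.weight i * invSum M m i / ((n - 1).choose (m - 1) : ℝ) := by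
  unfold bordaScore invSum
  congr 1
  rw [Finset.mul_sum]
  refine Finset.sum_congr rfl fun U hU => ?_
  simp only [MNL.choice, (Finset.mem_filter.1 hU).2.2, if_true]
  ring

lemma invSum_apply_perm {n : ℕ} (M : MNL n) (m : ℕ) (σ : Equiv.Perm (Fin n)) (i : Fin n) :
    invSum M m (σ i) =
      ∑ U : Finset (Fin n) with U.card = m ∧ i ∈ U, 1 / ∑ k ∈ U, M.weight (σ k) := by
  unfold invSum
  symm
  refine Finset.sum_equiv σ.finsetCongr (fun U => ?_) fun U _ => ?_
  · simp
  · simp [Equiv.finsetCongr_apply, Finset.sum_map]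

lemma invSum_pos {n : ℕ} (M : MNL n) {m : ℕ} (hm : 1 ≤ m) (hmn : m ≤ n) (i : Fin n) :
    0 < invSum M m i := by
  obtain ⟨U, hiU, -, hU⟩ := Finset.exists_subsuperset_card_eq
    (Finset.singleton_subset_iff.2 (Finset.mem_univ i)) (by simpa using hm) (by simpa using hmn)
  refine Finset.sum_pos (fun V hV => one_div_pos.2 (M.weight_sum_pos ⟨i, ?_⟩)) ⟨U, ?_⟩
  · exact (Finset.mem_filter.1 hV).2.2
  · simpa [hU] using hiU

lemma twoLevel_weight_of_mem {n K : ℕ} {v δ : ℝ} (hδ : 0 < δ) (hδv : δ < v) {S : KSubset n K}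
    {i : Fin n} (hi : i ∈ S.1) : (twoLevel v δ hδ hδv S).weight i = v + δ := by
  simp [twoLevel, hi]

lemma twoLevel_weight_of_notMem {n K : ℕ} {v δ : ℝ} (hδ : 0 < δ) (hδv : δ < v)
    {S : KSubset n K} {i : Fin n} (hi : i ∉ S.1) : (twoLevel v δ hδ hδv S).weight i = v := by
  simp [twoLevel, hi]

/-- Relabeling the items carries one two-level model to another, so the score of an item depends
only on whether the item is in the top set. -/
lemma invSum_twoLevel_eq {n K : ℕ} {v δ : ℝ} (hδ : 0 < δ) (hδv : δ < v) (m : ℕ)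
    (S S' : KSubset n K) {i i' : Fin n} (hii' : i ∈ S.1 ↔ i' ∈ S'.1) :
    invSum (twoLevel v δ hδ hδv S') m i' = invSum (twoLevel v δ hδ hδv S) m i := by
  classical
  have hcard : Fintype.card {x // x ∈ S.1} = Fintype.card {x // x ∈ S'.1} := by
    simp [S.2, S'.2]
  set σ : Equiv.Perm (Fin n) := (Fintype.equivOfCardEq hcard).extendSubtype with hσ
  have hσS : ∀ k, σ k ∈ S'.1 ↔ k ∈ S.1 := by
    intro k
    constructor
    · intro h
      by_contra hk
      exact (Fintype.equivOfCardEq hcard).extendSubtype_not_mem k hk h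
    · exact fun h => (Fintype.equivOfCardEq hcard).extendSubtype_mem k h
  set ρ : Equiv.Perm (Fin n) := σ.trans (Equiv.swap (σ i) i') with hρ
  have hρi : ρ i = i' := by simp [hρ]
  have hρS : ∀ k, ρ k ∈ S'.1 ↔ k ∈ S.1 := by
    intro k
    rw [← hσS k]
    simp only [hρ, Equiv.trans_apply]
    have h1 : σ i ∈ S'.1 ↔ i' ∈ S'.1 := (hσS i).trans hii'
    rcases eq_or_ne (σ k) (σ i) with h | h
    · rw [h, Equiv.swap_apply_left, h1]
    rcases eq_or_ne (σ k) i' with h' | h'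
    · rw [h', Equiv.swap_apply_right, h1]
    · rw [Equiv.swap_apply_of_ne_of_ne h h']
  rw [← hρi, invSum_apply_perm]
  unfold invSum
  refine Finset.sum_congr rfl fun U _ => ?_
  congr 1
  refine Finset.sum_congr rfl fun k _ => ?_
  simp [twoLevel, hρS k]

/-- On a menu `U` that contains the top item `i`, exchanging the weights of `i` and of an item `j`
outside the top set loses at least the fraction `(1 - 1 / m) δ / (v + δ)` of the probability of
the item. -/
lemma swap_menu_gap {n K : ℕ} {v δ : ℝ} (hδ : 0 < δ) (hδv : δ < v) {m : ℕ} (hm : 1 ≤ m)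
    {S : KSubset n K} {i j : Fin n} (hi : i ∈ S.1) (hj : j ∉ S.1) {U : Finset (Fin n)}
    (hU : U.card = m) (hiU : i ∈ U) :
    (1 - 1 / (m : ℝ)) * δ * (1 / ∑ k ∈ U, (twoLevel v δ hδ hδv S).weight k) ≤
      (v + δ) * (1 / ∑ k ∈ U, (twoLevel v δ hδ hδv S).weight k) -
      v * (1 / ∑ k ∈ U, (twoLevel v δ hδ hδv S).weight (Equiv.swap i j k)) := by
  set w := (twoLevel v δ hδ hδv S).weight with hw
  have hv : 0 < v := hδ.trans hδv
  have hm0 : (0 : ℝ) < m := by exact_mod_cast hm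
  have hij : i ≠ j := fun h => hj (h ▸ hi)
  have hwi : w i = v + δ := twoLevel_weight_of_mem hδ hδv hi
  have hwj : w j = v := twoLevel_weight_of_notMem hδ hδv hj
  have hwv : ∀ k, v ≤ w k := by
    intro k
    simp only [hw, twoLevel]
    split_ifs <;> linarith
  have hW' : (m : ℝ) * v ≤ ∑ k ∈ U, w (Equiv.swap i j k) := by
    rw [← hU, ← nsmul_eq_mul]
    exact Finset.card_nsmul_le_sum _ _ _ fun k _ => hwv _
  have hdiff : ∑ k ∈ U, w (Equiv.swap i j k) = ∑ k ∈ U, w k - δ + if j ∈ U then δ else 0 := by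
    have h1 : ∀ k ∈ U, w (Equiv.swap i j k) =
        w k + ((if k = i then -δ else 0) + (if k = j then δ else 0)) := by
      intro k _
      rcases eq_or_ne k i with rfl | hki
      · simp only [Equiv.swap_apply_left, hwi, hwj, if_true, hij, if_false]; ring
      rcases eq_or_ne k j with rfl | hkj
      · simp only [Equiv.swap_apply_right, hwi, hwj, if_true, hki, if_false]; ring
      · simp [Equiv.swap_apply_of_ne_of_ne hki hkj, hki, hkj]
    rw [Finset.sum_congr rfl h1, Finset.sum_add_distrib, Finset.sum_add_distrib,
      Finset.sum_ite_eq' U i, Finset.sum_ite_eq' U j]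
    simp only [hiU, if_true]
    ring
  set W := ∑ k ∈ U, w k with hWdef
  have h1m : 1 / (m : ℝ) ≤ 1 := by
    rw [div_le_one hm0]; exact_mod_cast hm
  split_ifs at hdiff with hjU
  · have hW : 0 < W := by
      have : 0 < (m : ℝ) * v := mul_pos hm0 hv
      linarith
    rw [hdiff, show W - δ + δ = W by ring, ← sub_mul]
    refine mul_le_mul_of_nonneg_right ?_ (one_div_pos.2 hW).le
    have : 0 ≤ 1 / (m : ℝ) * δ := by positivity
    linarith
  · set W' := ∑ k ∈ U, w (Equiv.swap i j k) with hW'def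
    have hWW : W = W' + δ := by linarith
    have hW'pos : 0 < W' := lt_of_lt_of_le (mul_pos hm0 hv) hW'
    have hkey : (v + δ) * (1 / W) - v * (1 / W') = (1 - v / W') * δ * (1 / W) := by
      rw [hWW]
      field_simp
      ring
    rw [hkey]
    have hWpos : 0 < W := by linarith
    refine mul_le_mul_of_nonneg_right (mul_le_mul_of_nonneg_right ?_ hδ.le)
      (one_div_pos.2 hWpos).le
    have : v / W' ≤ 1 / m := by
      rw [div_le_div_iff₀ hW'pos hm0]
      linarith
    linarith

/-- The relative gap between the score of a top item and that of another item. -/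
lemma bordaScore_gap {n K : ℕ} {v δ : ℝ} (hδ : 0 < δ) (hδv : δ < v) {m : ℕ} (hm : 1 ≤ m)
    {S : KSubset n K} {i j : Fin n} (hi : i ∈ S.1) (hj : j ∉ S.1) :
    (1 - 1 / (m : ℝ)) * (δ / (v + δ)) * bordaScore (twoLevel v δ hδ hδv S).choice m i ≤
      bordaScore (twoLevel v δ hδ hδv S).choice m i -
      bordaScore (twoLevel v δ hδ hδv S).choice m j := by
  have hv : 0 < v := hδ.trans hδv
  rw [bordaScore_eq, bordaScore_eq, twoLevel_weight_of_mem hδ hδv hi,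
    twoLevel_weight_of_notMem hδ hδv hj, ← sub_div]
  have hj' : j = Equiv.swap i j i := by simp
  have hinv : invSum (twoLevel v δ hδ hδv S) m j =
      ∑ U : Finset (Fin n) with U.card = m ∧ i ∈ U,
        1 / ∑ k ∈ U, (twoLevel v δ hδ hδv S).weight (Equiv.swap i j k) := by
    conv_lhs => rw [hj']
    exact invSum_apply_perm _ _ _ _
  have hmain : (1 - 1 / (m : ℝ)) * δ * invSum (twoLevel v δ hδ hδv S) m i ≤
      (v + δ) * invSum (twoLevel v δ hδ hδv S) m i -
        v * invSum (twoLevel v δ hδ hδv S) m j := by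
    rw [hinv, invSum, Finset.mul_sum, Finset.mul_sum, Finset.mul_sum, ← Finset.sum_sub_distrib]
    refine Finset.sum_le_sum fun U hU => ?_
    obtain ⟨-, hU, hiU⟩ := Finset.mem_filter.1 hU
    exact swap_menu_gap hδ hδv hm hi hj hU hiU
  rw [← mul_div_assoc]
  refine div_le_div_of_nonneg_right (le_trans (le_of_eq ?_) hmain) (Nat.cast_nonneg _)
  have : v + δ ≠ 0 := by positivity
  field_simp

/-! ### The order statistics of the scores -/

lemma kthLargest_ite_of_le {n : ℕ} (S : Finset (Fin n)) {a b : ℝ} (hba : b < a) {k : ℕ}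
    (hk : 1 ≤ k) (hkS : k ≤ S.card) : kthLargest (fun i => if i ∈ S then a else b) k = a := by
  have : {t : ℝ | k ≤ (Finset.univ.filter fun i : Fin n => t ≤ if i ∈ S then a else b).card} =
      Set.Iic a := by
    ext t
    simp only [Set.mem_ofPred_eq, Set.mem_Iic]
    constructor
    · intro h
      obtain ⟨i, hi⟩ := Finset.card_pos.1 (lt_of_lt_of_le hk h)
      have := (Finset.mem_filter.1 hi).2
      split_ifs at this <;> linarith
    · intro h
      refine hkS.trans (Finset.card_le_card fun i hi => ?_)
      simp [hi, h]
  rw [kthLargest, this, csSup_Iic]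

lemma kthLargest_ite_of_lt {n : ℕ} (S : Finset (Fin n)) {a b : ℝ} (hba : b < a) {k : ℕ}
    (hkS : S.card < k) (hkn : k ≤ n) : kthLargest (fun i => if i ∈ S then a else b) k = b := by
  have : {t : ℝ | k ≤ (Finset.univ.filter fun i : Fin n => t ≤ if i ∈ S then a else b).card} =
      Set.Iic b := by
    ext t
    simp only [Set.mem_ofPred_eq, Set.mem_Iic]
    constructor
    · intro h
      by_contra! ht
      refine absurd (h.trans (Finset.card_le_card (t := S) fun i hi => ?_)) (not_le.2 hkS)
      by_contra hiS
      have := (Finset.mem_filter.1 hi).2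
      rw [if_neg hiS] at this
      linarith
    · intro h
      refine hkn.trans (le_of_eq ?_)
      rw [Finset.filter_true_of_mem, Finset.card_univ, Fintype.card_fin]
      intro i _
      split_ifs <;> linarith
  rw [kthLargest, this, csSup_Iic]

lemma bordaScore_twoLevel_eq {n K : ℕ} {v δ : ℝ} (hδ : 0 < δ) (hδv : δ < v) (m : ℕ)
    (S S' : KSubset n K) {i i' : Fin n} (hii' : i ∈ S.1 ↔ i' ∈ S'.1) :
    bordaScore (twoLevel v δ hδ hδv S').choice m i' =
      bordaScore (twoLevel v δ hδ hδv S).choice m i := by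
  rw [bordaScore_eq, bordaScore_eq, invSum_twoLevel_eq hδ hδv m S S' hii']
  simp [twoLevel, hii']

lemma bordaScore_pos {n : ℕ} (M : MNL n) {m : ℕ} (hm : 1 ≤ m) (hmn : m ≤ n) (i : Fin n) :
    0 < bordaScore M.choice m i := by
  rw [bordaScore_eq]
  have : 0 < (n - 1).choose (m - 1) := Nat.choose_pos (by omega)
  exact div_pos (mul_pos (M.weight_pos i) (invSum_pos M hm hmn i)) (by exact_mod_cast this)

/-- In a two-level model the `k`-th largest score is the common score of the top items for `k ≤ K`
and the common score of the other items for `k > K`. -/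
lemma tau_twoLevel {n K : ℕ} {v δ : ℝ} (hδ : 0 < δ) (hδv : δ < v) {m : ℕ} (hm : 2 ≤ m)
    (hmn : m ≤ n) (S : KSubset n K) {i j : Fin n} (hi : i ∈ S.1) (hj : j ∉ S.1) :
    (∀ k, 1 ≤ k → k ≤ K → tau (twoLevel v δ hδ hδv S).choice m k =
      bordaScore (twoLevel v δ hδ hδv S).choice m i) ∧
    (∀ k, K < k → k ≤ n → tau (twoLevel v δ hδ hδv S).choice m k =
      bordaScore (twoLevel v δ hδ hδv S).choice m j) := by
  have hv : 0 < v := hδ.trans hδv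
  have hf : bordaScore (twoLevel v δ hδ hδv S).choice m = fun k => if k ∈ S.1 then
      bordaScore (twoLevel v δ hδ hδv S).choice m i else
      bordaScore (twoLevel v δ hδ hδv S).choice m j := by
    funext k
    split_ifs with hk
    · exact bordaScore_twoLevel_eq hδ hδv m S S (by simp [hk, hi])
    · exact bordaScore_twoLevel_eq hδ hδv m S S (by simp [hk, hj])
  have hlt : bordaScore (twoLevel v δ hδ hδv S).choice m j <
      bordaScore (twoLevel v δ hδ hδv S).choice m i := by
    have h1 := bordaScore_gap hδ hδv (by omega : 1 ≤ m) hi hj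
    have h2 := bordaScore_pos (twoLevel v δ hδ hδv S) (by omega : 1 ≤ m) hmn i
    have h3 : 0 < 1 - 1 / (m : ℝ) := by
      rw [sub_pos, div_lt_one (by positivity)]
      exact_mod_cast hm
    have h4 : 0 < (1 - 1 / (m : ℝ)) * (δ / (v + δ)) *
        bordaScore (twoLevel v δ hδ hδv S).choice m i := by positivity
    linarith
  constructor
  · intro k hk hkK
    refine (congrArg (fun f => kthLargest f k) hf).trans ?_
    exact kthLargest_ite_of_le S.1 hlt hk (by rw [S.2]; exact hkK)
  · intro k hk hkn
    refine (congrArg (fun f => kthLargest f k) hf).trans ?_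
    exact kthLargest_ite_of_lt S.1 hlt (by rw [S.2]; exact hk) hkn

end TopKChoice

/-! ### Logarithmic inequalities -/

lemma log_one_sub_le_sub_sq {z : ℝ} (h0 : 0 ≤ z) (h1 : z < 1) :
    Real.log (1 - z) ≤ -z - z ^ 2 / 2 := by
  have h := Real.hasSum_pow_div_log_of_abs_lt_one (by rwa [abs_of_nonneg h0])
  have h2 := sum_le_hasSum (Finset.range 2) (fun i _ => by positivity) h
  simp only [Finset.sum_range_succ, Finset.sum_range_zero] at h2
  norm_num at h2
  linarith

/-- A Padé upper bound for the logarithm. -/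
lemma log_one_add_le_pade {z : ℝ} (h0 : 0 ≤ z) :
    Real.log (1 + z) ≤ z * (6 + z) / (6 + 4 * z) := by
  have hd : ∀ y ∈ Set.Ici (0 : ℝ), HasDerivAt
      (fun y : ℝ => y * (6 + y) / (6 + 4 * y) - Real.log (1 + y))
      (((1 * (6 + y) + y * 1) * (6 + 4 * y) - y * (6 + y) * (4 * 1)) / (6 + 4 * y) ^ 2
        - 1 / (1 + y)) y := by
    intro y hy
    have hy : (0 : ℝ) ≤ y := hy
    have h1 : HasDerivAt (fun y : ℝ => y * (6 + y)) (1 * (6 + y) + y * 1) y :=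
      (hasDerivAt_id y).mul ((hasDerivAt_id y).const_add 6)
    have h2 : HasDerivAt (fun y : ℝ => 6 + 4 * y) (4 * 1) y :=
      ((hasDerivAt_id y).const_mul 4).const_add 6
    have h3 : HasDerivAt (fun y : ℝ => Real.log (1 + y)) (1 / (1 + y)) y :=
      ((hasDerivAt_id y).const_add 1).log (by simp only [id]; linarith)
    exact (h1.div h2 (by linarith)).sub h3
  have hmono : MonotoneOn (fun y : ℝ => y * (6 + y) / (6 + 4 * y) - Real.log (1 + y))
      (Set.Ici 0) := by
    refine monotoneOn_of_deriv_nonneg (convex_Ici 0)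
      (fun y hy => (hd y hy).continuousAt.continuousWithinAt)
      (fun y hy => (hd y (interior_subset hy)).differentiableAt.differentiableWithinAt)
      fun y hy => ?_
    have hy0 : (0 : ℝ) ≤ y := interior_subset hy
    rw [(hd y (interior_subset hy)).deriv, sub_nonneg,
      div_le_div_iff₀ (by linarith) (by positivity)]
    have : 0 ≤ y ^ 3 := by positivity
    nlinarith
  have := hmono (Set.mem_Ici.2 le_rfl) (Set.mem_Ici.2 h0) h0
  simp at this
  linarith

/-- The numerical constant of the divergence bound for raised weights; `y` stands for `1 / m`. -/
lemma raise_const_le {x y : ℝ} (hx0 : 0 ≤ x) (hx1 : x ≤ 1) (hy : y ≤ 1 / 2) :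
    (1 + x) * ((1 + x) * Real.log (1 + x) - x - x ^ 2 * y / (2 * (1 + x))) ≤
      12 / 5 * (1 - y) ^ 2 * x ^ 2 := by
  have hL := log_one_add_le_pade hx0
  have h1 : (1 + x) * ((1 + x) * Real.log (1 + x) - x - x ^ 2 * y / (2 * (1 + x))) =
      (1 + x) ^ 2 * Real.log (1 + x) - x * (1 + x) - x ^ 2 * y / 2 := by
    field_simp
  have h2 : (1 + x) ^ 2 * (x * (6 + x) / (6 + 4 * x)) - x * (1 + x) =
      x ^ 2 * ((1 + x) * (3 + x) / (6 + 4 * x)) := by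
    field_simp
    ring
  have h3 : (1 + x) * (3 + x) / (6 + 4 * x) ≤ 4 / 5 := by
    rw [div_le_div_iff₀ (by linarith) (by norm_num)]
    nlinarith
  have h4 : 4 / 5 - y / 2 ≤ 12 / 5 * (1 - y) ^ 2 := by nlinarith
  have h5 := mul_le_mul_of_nonneg_left hL (sq_nonneg (1 + x))
  have h6 := mul_le_mul_of_nonneg_left h3 (sq_nonneg x)
  have h7 := mul_le_mul_of_nonneg_left h4 (sq_nonneg x)
  rw [h1]
  linarith

/-- The numerical constant of the divergence bound for lowered weights; `y` stands for `1 / m`. -/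
lemma lower_const_le {x y : ℝ} (hx0 : 0 ≤ x) (hx1 : x ≤ 1) (hy0 : 0 ≤ y) (hy : y ≤ 1 / 2) :
    (1 + x) * (1 + x * y) *
      (x - Real.log (1 + x) - 3 * x ^ 2 * y / (6 + (6 - 2 * y) * x)) ≤
      12 / 5 * (1 - y) ^ 2 * x ^ 2 := by
  have hL := Real.le_log_one_add_of_nonneg hx0
  have hxy : 0 ≤ x * y := mul_nonneg hx0 hy0
  have hd : 0 < 6 + (6 - 2 * y) * x := by nlinarith
  have h1 : x - 2 * x / (x + 2) - 3 * x ^ 2 * y / (6 + (6 - 2 * y) * x) =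
      x ^ 2 * ((6 * (1 + x) - 6 * y - 5 * (x * y)) / ((2 + x) * (6 + (6 - 2 * y) * x))) := by
    rw [show 6 * (1 + x) - 6 * y - 5 * (x * y) =
      (6 + (6 - 2 * y) * x) - 3 * y * (2 + x) by ring]
    generalize 6 + (6 - 2 * y) * x = D at hd
    have : x + 2 ≠ 0 := by positivity
    have : 2 + x ≠ 0 := by positivity
    have := hd.ne'
    field_simp
    ring
  have h2 : (1 + x) * (1 + x * y) *
      ((6 * (1 + x) - 6 * y - 5 * (x * y)) / ((2 + x) * (6 + (6 - 2 * y) * x))) ≤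
      12 / 5 * (1 - y) ^ 2 := by
    rw [← mul_div_assoc, div_le_iff₀ (by positivity)]
    -- In the Bernstein basis of degree `(3, 3)` on the rectangle all coefficients are positive.
    have hB : ∀ i i' j j' : ℕ, 0 ≤ x ^ i * (1 - x) ^ i' * y ^ j * (1 - 2 * y) ^ j' := by
      intro i i' j j'
      have h1 : 0 ≤ 1 - x := by linarith
      have h2 : 0 ≤ 1 - 2 * y := by linarith
      positivity
    linarith [hB 0 3 0 3, hB 0 3 1 2, hB 0 3 2 1, hB 0 3 3 0, hB 1 2 0 3, hB 1 2 1 2, hB 1 2 2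
      1, hB 1 2 3 0, hB 2 1 0 3, hB 2 1 1 2, hB 2 1 2 1, hB 2 1 3 0, hB 3 0 0 3, hB 3 0 1 2, hB
      3 0 2 1, hB 3 0 3 0]
  have h3 : 0 ≤ (1 + x) * (1 + x * y) := by positivity
  have h4 := mul_le_mul_of_nonneg_left (sub_le_sub_right (sub_le_sub_left hL x)
    (3 * x ^ 2 * y / (6 + (6 - 2 * y) * x))) h3
  rw [h1] at h4
  have h5 := mul_le_mul_of_nonneg_left h2 (sq_nonneg x)
  linarith

namespace TopKChoice

/-! ### Divergence of a single choice -/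

lemma menuDiv_eq {n : ℕ} (M M₀ : MNL n) {U A : Finset (Fin n)} (hU : U.Nonempty) {a b : ℝ}
    (ha : ∀ k ∈ A, M.weight k = a) (hb : ∀ k ∈ A, M₀.weight k = b)
    (hout : ∀ k ∉ A, M.weight k = M₀.weight k) :
    menuDiv M M₀ U = (U ∩ A).card * (a / ∑ k ∈ U, M.weight k) * Real.log (a / b) +
      Real.log ((∑ k ∈ U, M₀.weight k) / ∑ k ∈ U, M.weight k) := by
  have hW := M.weight_sum_pos hU
  have hW₀ := M₀.weight_sum_pos hU
  set W := ∑ k ∈ U, M.weight k with hWd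
  set W₀ := ∑ k ∈ U, M₀.weight k with hW₀d
  have h1 : ∀ i, M.choice i U * Real.log (M.choice i U / M₀.choice i U) =
      if i ∈ U then (if i ∈ A then a / W * Real.log (a / b) else 0) +
        M.weight i / W * Real.log (W₀ / W) else 0 := by
    intro i
    by_cases hi : i ∈ U
    · simp only [MNL.choice, hi, if_true, ← hWd, ← hW₀d]
      have hwi := M.weight_pos i
      have hwi₀ := M₀.weight_pos i
      have h2 : M.weight i / W / (M₀.weight i / W₀) = M.weight i / M₀.weight i * (W₀ / W) := by
        field_simp
      rw [h2, Real.log_mul (div_pos hwi hwi₀).ne' (div_pos hW₀ hW).ne']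
      by_cases hiA : i ∈ A
      · simp only [hiA, if_true, ha i hiA, hb i hiA]; ring
      · simp only [hiA, if_false, hout i hiA, div_self hwi₀.ne', Real.log_one,
          zero_add]
    · simp [MNL.choice, hi]
  unfold menuDiv
  simp only [h1]
  rw [Finset.sum_ite_mem, Finset.univ_inter, Finset.sum_add_distrib, ← Finset.sum_mul,
    ← Finset.sum_div, ← hWd, div_self hW.ne', one_mul, Finset.sum_ite_mem, Finset.sum_const,
    nsmul_eq_mul, mul_assoc]

lemma sum_weight_add {n : ℕ} (M M₀ : MNL n) {A : Finset (Fin n)} {δ : ℝ}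
    (h : ∀ k, M.weight k = M₀.weight k + if k ∈ A then δ else 0) (U : Finset (Fin n)) :
    ∑ k ∈ U, M.weight k = ∑ k ∈ U, M₀.weight k + (U ∩ A).card * δ := by
  rw [Finset.sum_congr rfl fun k _ => h k, Finset.sum_add_distrib, Finset.sum_ite_mem,
    Finset.sum_const, nsmul_eq_mul]

/-- Raising the weights of the items of `A` from `v` to `v + δ`: the divergence of one choice is
proportional to the number of items of `A` on the menu. The subtracted term is the second order
effect of the normalization; it keeps the constant small on menus of two items. -/
lemma menuDiv_raise_le {n : ℕ} (M M₀ : MNL n) {U A : Finset (Fin n)} (hU : U.Nonempty) {v δ : ℝ}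
    (hv : 0 < v) (hδ : 0 < δ) (hA : ∀ k ∈ A, M₀.weight k = v)
    (h : ∀ k, M.weight k = M₀.weight k + if k ∈ A then δ else 0)
    (hle : ∀ k, M.weight k ≤ v + δ) :
    menuDiv M M₀ U ≤ (U ∩ A).card * (v * (1 / ∑ k ∈ U, M.weight k)) *
      ((1 + δ / v) * Real.log (1 + δ / v) - δ / v -
        (δ / v) ^ 2 * (1 / (U.card : ℝ)) / (2 * (1 + δ / v))) := by
  rw [menuDiv_eq M M₀ (A := A) hU (a := v + δ) (b := v)
    (fun k hk => by rw [h k, hA k hk, if_pos hk]) hA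
    (fun k hk => by rw [h k, if_neg hk, add_zero])]
  have hW := M.weight_sum_pos hU
  have hW₀ := M₀.weight_sum_pos hU
  have hsum := sum_weight_add M M₀ h U
  have hWle : ∑ k ∈ U, M.weight k ≤ U.card * (v + δ) := by
    rw [← nsmul_eq_mul]
    exact Finset.sum_le_card_nsmul _ _ _ fun k _ => hle k
  have hm : (0 : ℝ) < U.card := by exact_mod_cast hU.card_pos
  set W := ∑ k ∈ U, M.weight k
  set W₀ := ∑ k ∈ U, M₀.weight k
  set α : ℝ := ((U ∩ A).card : ℝ) with hα
  have hα0 : 0 ≤ α := Nat.cast_nonneg _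
  have hα2 : α ≤ α ^ 2 := by
    rw [hα]; exact_mod_cast Nat.le_self_pow two_ne_zero _
  obtain ⟨x, rfl⟩ : ∃ x, δ = x * v := ⟨δ / v, by field_simp⟩
  have hx : 0 < x := by
    by_contra! hx; nlinarith
  rw [mul_div_cancel_right₀ x hv.ne', show (v + x * v) / v = 1 + x by field_simp,
    show W₀ / W = 1 - α * x * v / W by rw [hsum]; field_simp; ring]
  have hlog := log_one_sub_le_sub_sq (z := α * x * v / W) (by positivity) (by
    rw [div_lt_one hW]; linarith)
  have hsq : α * (v * (1 / W)) * (x ^ 2 * (1 / U.card) / (2 * (1 + x))) ≤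
      (α * x * v / W) ^ 2 / 2 := by
    have h1 : (α * x * v / W) ^ 2 / 2 = α ^ 2 * (v / W) * (x ^ 2 / 2) * (v / W) := by ring
    have h2 : α * (v * (1 / W)) * (x ^ 2 * (1 / U.card) / (2 * (1 + x))) =
        α * (v / W) * (x ^ 2 / 2) * (1 / (U.card * (1 + x))) := by
      field_simp
    rw [h1, h2]
    have h3 : 1 / (U.card * (1 + x)) ≤ v / W := by
      rw [div_le_div_iff₀ (by positivity) hW]
      nlinarith
    gcongr
  have h4 : α * ((v + x * v) / W) * Real.log (1 + x) - α * x * v / W =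
      α * (v * (1 / W)) * ((1 + x) * Real.log (1 + x) - x) := by ring
  rw [mul_sub]
  linarith

/-- Lowering the weights of the items of `A` from `v + δ` to `v`: the counterpart of
`menuDiv_raise_le`. -/
lemma menuDiv_lower_le {n : ℕ} (M M₀ : MNL n) {U A : Finset (Fin n)} (hU : U.Nonempty) {v δ : ℝ}
    (hv : 0 < v) (hδ : 0 < δ) (hA : ∀ k ∈ A, M.weight k = v)
    (h : ∀ k, M₀.weight k = M.weight k + if k ∈ A then δ else 0)
    (hle : ∀ k, M.weight k ≤ v + δ) :
    menuDiv M M₀ U ≤ (U ∩ A).card * (v * (1 / ∑ k ∈ U, M.weight k)) *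
      (δ / v - Real.log (1 + δ / v) - 3 * (δ / v) ^ 2 * (1 / (U.card : ℝ)) /
        (6 + (6 - 2 * (1 / (U.card : ℝ))) * (δ / v))) := by
  rw [menuDiv_eq M M₀ (A := A) hU (a := v) (b := v + δ) hA
    (fun k hk => by rw [h k, hA k hk, if_pos hk])
    (fun k hk => by rw [h k, if_neg hk, add_zero])]
  have hW := M.weight_sum_pos hU
  have hsum := sum_weight_add M₀ M h U
  rcases (U ∩ A).eq_empty_or_nonempty with hem | hne
  · rw [hem] at hsum ⊢
    simp only [Finset.card_empty, Nat.cast_zero, zero_mul, add_zero] at hsum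
    simp [hsum, hW.ne']
  have hWle : ∑ k ∈ U, M.weight k ≤ U.card * (v + δ) - δ := by
    obtain ⟨i, hi⟩ := hne
    obtain ⟨hiU, hiA⟩ := Finset.mem_inter.1 hi
    rw [← Finset.add_sum_erase U _ hiU, hA i hiA]
    have h1 : ∑ k ∈ U.erase i, M.weight k ≤ (U.erase i).card * (v + δ) := by
      rw [← nsmul_eq_mul]
      exact Finset.sum_le_card_nsmul _ _ _ fun k _ => hle k
    have h2 : ((U.erase i).card : ℝ) + 1 = U.card := by
      exact_mod_cast Finset.card_erase_add_one hiU
    nlinarith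
  have hm : (1 : ℝ) ≤ U.card := by exact_mod_cast hU.card_pos
  have hα1 : (1 : ℝ) ≤ ((U ∩ A).card : ℝ) := by exact_mod_cast hne.card_pos
  set W := ∑ k ∈ U, M.weight k
  set W₀ := ∑ k ∈ U, M₀.weight k
  set α : ℝ := ((U ∩ A).card : ℝ)
  set m : ℝ := (U.card : ℝ)
  obtain ⟨x, rfl⟩ : ∃ x, δ = x * v := ⟨δ / v, by field_simp⟩
  have hx : 0 < x := by
    by_contra! hx; nlinarith
  set y : ℝ := x * (v / W) with hy
  have hy0 : 0 < y := by positivity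
  rw [mul_div_cancel_right₀ x hv.ne', show v / (v + x * v) = (1 + x)⁻¹ by field_simp,
    Real.log_inv, show W₀ / W = 1 + α * y by rw [hsum, hy]; field_simp]
  have hlog := log_one_add_le_pade (z := α * y) (by positivity)
  have hpade : α * y * (6 + α * y) / (6 + 4 * (α * y)) ≤ α * y - α * y * (3 * y / (6 + 4 * y)) := by
    have h1 : α * y * (6 + α * y) / (6 + 4 * (α * y)) =
        α * y - α * y * (3 * (α * y) / (6 + 4 * (α * y))) := by
      field_simp
      ring
    rw [h1]
    have h2 : 3 * y / (6 + 4 * y) ≤ 3 * (α * y) / (6 + 4 * (α * y)) := by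
      rw [div_le_div_iff₀ (by positivity) (by positivity)]
      nlinarith
    have h3 : 0 ≤ α * y := by positivity
    nlinarith [mul_le_mul_of_nonneg_left h2 h3]
  have hd : 0 < 6 + (6 - 2 * (1 / m)) * x := by
    have : 1 / m ≤ 1 := by rw [div_le_one (by linarith)]; exact hm
    nlinarith
  have hylow : 3 * x * (1 / m) / (6 + (6 - 2 * (1 / m)) * x) ≤ 3 * y / (6 + 4 * y) := by
    have h1 : 3 * y / (6 + 4 * y) = 3 * x * v / (6 * W + 4 * x * v) := by
      rw [hy]; field_simp
    have h2 : 3 * x * (1 / m) / (6 + (6 - 2 * (1 / m)) * x) =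
        3 * x / (6 * m + (6 * m - 2) * x) := by
      have : 6 + (6 - 2 * (1 / m)) * x = (6 * m + (6 * m - 2) * x) / m := by
        field_simp
      rw [this]
      field_simp
    rw [h1, h2, div_le_div_iff₀ (by nlinarith) (by positivity)]
    have h3 : 0 ≤ 3 * x := by positivity
    nlinarith [mul_le_mul_of_nonneg_left hWle h3]
  have h5 := mul_le_mul_of_nonneg_left hylow (by positivity : 0 ≤ α * y)
  have h6 : α * y * (3 * x * (1 / m) / (6 + (6 - 2 * (1 / m)) * x)) =
      α * (v * (1 / W)) * (3 * x ^ 2 * (1 / m) / (6 + (6 - 2 * (1 / m)) * x)) := by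
    rw [hy]; ring
  have h7 : α * y = α * (v * (1 / W)) * x := by rw [hy]; ring
  have h8 : α * (v / W) * -Real.log (1 + x) = - (α * (v * (1 / W)) * Real.log (1 + x)) := by ring
  rw [h8, mul_sub, mul_sub]
  linarith

/-- The divergence bounds of the menus add up to inverse weight sums of the items of `A`. -/
lemma sum_menu_card_inter {n : ℕ} (M : MNL n) (m : ℕ) (A : Finset (Fin n)) :
    ∑ U : Menu n m, ((U.1 ∩ A).card : ℝ) * (1 / ∑ k ∈ U.1, M.weight k) =
      ∑ i ∈ A, invSum M m i := by
  have h1 : ∑ U : Menu n m, ((U.1 ∩ A).card : ℝ) * (1 / ∑ k ∈ U.1, M.weight k) =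
      ∑ U : Finset (Fin n) with U.card = m, ((U ∩ A).card : ℝ) * (1 / ∑ k ∈ U, M.weight k) := by
    symm
    exact Finset.sum_subtype _ (by simp) _
  rw [h1]
  unfold invSum
  simp only [Finset.sum_filter]
  rw [Finset.sum_comm]
  refine Finset.sum_congr rfl fun U _ => ?_
  by_cases hU : U.card = m
  · simp only [hU, if_true, true_and]
    rw [← Finset.sum_filter, Finset.sum_const, nsmul_eq_mul, Finset.filter_mem_eq_inter,
      Finset.inter_comm]
  · simp [hU]

end TopKChoice

/-! ### Balls in the edit distance -/

/-- Within the sets that contain `Gᶜ`, a ball around an arbitrary set `T` is contained in the ball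
around a set that itself contains `Gᶜ`. -/
lemma exists_core_of_card_eq {α : Type*} [Fintype α] [DecidableEq α] (G T : Finset α) (q : ℕ)
    (hT : T.card = Gᶜ.card + q) :
    ∃ T' ⊆ G, T'.card = q ∧ ∀ A ⊆ G, (A \ T').card ≤ ((Gᶜ ∪ A) \ T).card := by
  have h1 : (T ∩ G).card + (T \ G).card = T.card := Finset.card_inter_add_card_sdiff T G
  have h2 : (Gᶜ ∩ T).card + (Gᶜ \ T).card = Gᶜ.card := Finset.card_inter_add_card_sdiff Gᶜ T
  have h3 : T \ G = Gᶜ ∩ T := by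
    ext x
    simp only [Finset.mem_sdiff, Finset.mem_inter, Finset.mem_compl]
    tauto
  rw [h3] at h1
  obtain ⟨T', hT', hcard⟩ := Finset.exists_subset_card_eq (s := T ∩ G) (n := q) (by omega)
  refine ⟨T', hT'.trans Finset.inter_subset_right, hcard, fun A hA => ?_⟩
  have h4 : A \ T' ⊆ A \ T ∪ (T ∩ G) \ T' := by
    intro x hx
    have := hA (Finset.mem_sdiff.1 hx).1
    simp only [Finset.mem_union, Finset.mem_sdiff, Finset.mem_inter] at hx ⊢
    tauto
  have h5 : ((T ∩ G) \ T').card + T'.card = (T ∩ G).card :=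
    Finset.card_sdiff_add_card_eq_card hT'
  have h6 : ((Gᶜ ∪ A) \ T).card = (Gᶜ \ T).card + (A \ T).card := by
    rw [Finset.union_sdiff_distrib, Finset.card_union_of_disjoint]
    refine Finset.disjoint_of_subset_left Finset.sdiff_subset
      (Finset.disjoint_of_subset_right Finset.sdiff_subset ?_)
    exact Finset.disjoint_left.2 fun x hx hxA => (Finset.mem_compl.1 hx) (hA hxA)
  have h7 := (Finset.card_le_card h4).trans (Finset.card_union_le _ _)
  omega

lemma card_ball_le_sum {α : Type*} [DecidableEq α] {G T : Finset α} (hTG : T ⊆ G) (h : ℕ) :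
    ((G.powersetCard T.card).filter fun A => (A \ T).card ≤ h).card ≤
      ∑ j ∈ Finset.range (h + 1), T.card.choose (T.card - j) * (G.card - T.card).choose j := by
  have hsub : ((G.powersetCard T.card).filter fun A => (A \ T).card ≤ h) ⊆
      (Finset.range (h + 1)).biUnion fun j =>
        (T.powersetCard (T.card - j) ×ˢ (G \ T).powersetCard j).image fun z => z.1 ∪ z.2 := by
    intro A hA
    obtain ⟨hA, hAh⟩ := Finset.mem_filter.1 hA
    obtain ⟨hAG, hAc⟩ := Finset.mem_powersetCard.1 hA
    have hc := Finset.card_inter_add_card_sdiff A T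
    refine Finset.mem_biUnion.2 ⟨(A \ T).card, Finset.mem_range.2 (by omega), ?_⟩
    refine Finset.mem_image.2 ⟨(A ∩ T, A \ T), ?_, ?_⟩
    · rw [Finset.mem_product, Finset.mem_powersetCard, Finset.mem_powersetCard]
      refine ⟨⟨Finset.inter_subset_right, ?_⟩, Finset.sdiff_subset_sdiff hAG le_rfl, rfl⟩
      change (A ∩ T).card = _
      omega
    · ext x
      simp only [Finset.mem_union, Finset.mem_inter, Finset.mem_sdiff]
      tauto
  refine (Finset.card_le_card hsub).trans (Finset.card_biUnion_le.trans
    (Finset.sum_le_sum fun j _ => Finset.card_image_le.trans (le_of_eq ?_)))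
  rw [Finset.card_product, Finset.card_powersetCard, Finset.card_powersetCard,
    Finset.card_sdiff_of_subset hTG]

/-- A set in the ball of radius `h` around `T` contains some `|T| - h` elements of `T`. -/
lemma card_ball_le_mul {α : Type*} [DecidableEq α] {G T : Finset α} (hTG : T ⊆ G) (h : ℕ) :
    ((G.powersetCard T.card).filter fun A => (A \ T).card ≤ h).card ≤
      T.card.choose (T.card - h) *
        (G.card - (T.card - h)).choose (T.card - (T.card - h)) := by
  have hsub : ((G.powersetCard T.card).filter fun A => (A \ T).card ≤ h) ⊆
      (T.powersetCard (T.card - h)).biUnion fun D =>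
        ((G \ D).powersetCard (T.card - (T.card - h))).image fun F => D ∪ F := by
    intro A hA
    obtain ⟨hA, hAh⟩ := Finset.mem_filter.1 hA
    obtain ⟨hAG, hAc⟩ := Finset.mem_powersetCard.1 hA
    have hc := Finset.card_inter_add_card_sdiff A T
    obtain ⟨D, hD, hDc⟩ := Finset.exists_subset_card_eq (s := A ∩ T) (n := T.card - h) (by omega)
    have hDA : D ⊆ A := hD.trans Finset.inter_subset_left
    refine Finset.mem_biUnion.2 ⟨D, Finset.mem_powersetCard.2
      ⟨hD.trans Finset.inter_subset_right, hDc⟩, Finset.mem_image.2 ⟨A \ D, ?_, ?_⟩⟩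
    · rw [Finset.mem_powersetCard, Finset.card_sdiff_of_subset hDA, hDc, hAc]
      exact ⟨Finset.sdiff_subset_sdiff hAG le_rfl, rfl⟩
    · exact Finset.union_sdiff_of_subset hDA
  refine (Finset.card_le_card hsub).trans (Finset.card_biUnion_le.trans
    ((Finset.sum_le_card_nsmul _ _ _ fun D hD => Finset.card_image_le.trans
      (le_of_eq ?_)).trans (le_of_eq (by
        rw [Finset.card_powersetCard, smul_eq_mul]))))
  obtain ⟨hDT, hDc⟩ := Finset.mem_powersetCard.1 hD
  rw [Finset.card_powersetCard, Finset.card_sdiff_of_subset (hDT.trans hTG), hDc]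

/-- A bound for the number of `q`-subsets of a set of size `N` that miss at most `h` elements of a
given `q`-subset: the smaller one of the exact count and of a union bound. -/
def ballBound (N q h : ℕ) : ℕ :=
  min (∑ j ∈ Finset.range (h + 1), q.choose (q - j) * (N - q).choose j)
    (q.choose (q - h) * (N - (q - h)).choose (q - (q - h)))

lemma card_ball_le_ballBound {α : Type*} [DecidableEq α] {G T : Finset α} (hTG : T ⊆ G) (h : ℕ) :
    ((G.powersetCard T.card).filter fun A => (A \ T).card ≤ h).card ≤
      ballBound G.card T.card h :=
  le_min (card_ball_le_sum hTG h) (card_ball_le_mul hTG h)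

/-! ### Numerical estimates -/

/-- The condition under which the family of the `q`-subsets of a set of size `N` defeats every
estimator with error radius `q - l`: with `r = C(q, l)² / C(N, l)`, the union bound for the
fraction of the family in a ball, it says `(4 / r) ^ (4 / 5) ≥ 5 n ^ (q / 40)`. -/
def Separated (q l N n : ℕ) : Prop :=
  5 ^ 40 * n ^ q * q.choose l ^ 64 ≤ (4 * N.choose l) ^ 32

lemma choose_mul_pow_le (l : ℕ) {N₀ N : ℕ} (hN : N₀ ≤ N) :
    N₀.choose l * N ^ l ≤ N.choose l * N₀ ^ l := by
  induction l with
  | zero => simp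
  | succ l ih =>
    refine Nat.le_of_mul_le_mul_right ?_ (Nat.succ_pos l)
    have h1 : (N₀ - l) * N ≤ (N - l) * N₀ := by
      rw [Nat.sub_mul, Nat.sub_mul, mul_comm N N₀]
      exact Nat.sub_le_sub_left (Nat.mul_le_mul_left l hN) _
    calc N₀.choose (l + 1) * N ^ (l + 1) * (l + 1)
        = N₀.choose (l + 1) * (l + 1) * N ^ (l + 1) := by ring
      _ = (N₀.choose l * N ^ l) * ((N₀ - l) * N) := by rw [Nat.choose_succ_right_eq]; ring
      _ ≤ (N.choose l * N₀ ^ l) * ((N - l) * N₀) := Nat.mul_le_mul ih h1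
      _ = N.choose (l + 1) * (l + 1) * N₀ ^ (l + 1) := by rw [Nat.choose_succ_right_eq]; ring
      _ = N.choose (l + 1) * N₀ ^ (l + 1) * (l + 1) := by ring

/-- Separation persists as the sizes grow, as long as `n` grows at most like `N²`. -/
lemma Separated.mono {q l N₀ n₀ N n : ℕ} (h : Separated q l N₀ n₀) (hN₀ : 0 < N₀) (hN : N₀ ≤ N)
    (hn : n * N₀ ^ 2 ≤ n₀ * N ^ 2) (hq : q ≤ 16 * l) : Separated q l N n := by
  unfold Separated at *
  obtain ⟨d, hd⟩ : ∃ d, 32 * l = 2 * q + d := ⟨32 * l - 2 * q, by omega⟩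
  refine Nat.le_of_mul_le_mul_right ?_ (pow_pos hN₀ (32 * l))
  calc 5 ^ 40 * n ^ q * q.choose l ^ 64 * N₀ ^ (32 * l)
      = 5 ^ 40 * q.choose l ^ 64 * ((n * N₀ ^ 2) ^ q * N₀ ^ d) := by
        rw [hd, pow_add, pow_mul, mul_pow]; ring
    _ ≤ 5 ^ 40 * q.choose l ^ 64 * ((n₀ * N ^ 2) ^ q * N ^ d) := by gcongr
    _ = 5 ^ 40 * n₀ ^ q * q.choose l ^ 64 * N ^ (32 * l) := by
        rw [hd, pow_add, pow_mul, mul_pow]; ring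
    _ ≤ (4 * N₀.choose l) ^ 32 * N ^ (32 * l) := Nat.mul_le_mul_right _ h
    _ = (4 * (N₀.choose l * N ^ l)) ^ 32 := by
        rw [mul_comm 32 l, pow_mul, ← mul_pow, mul_assoc]
    _ ≤ (4 * (N.choose l * N₀ ^ l)) ^ 32 := by
        exact Nat.pow_le_pow_left (Nat.mul_le_mul_left 4 (choose_mul_pow_le l hN)) 32
    _ = (4 * N.choose l) ^ 32 * N₀ ^ (32 * l) := by
        rw [mul_comm 32 l, pow_mul, ← mul_pow, mul_assoc]

lemma Separated.of_le_add {q l N₀ : ℕ} (e : ℕ) {N n : ℕ} (h : Separated q l N₀ (N₀ + e))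
    (hN₀ : 0 < N₀) (hN : N₀ ≤ N) (hn : n ≤ N + e) (hq : q ≤ 16 * l) : Separated q l N n := by
  refine h.mono hN₀ hN ?_ hq
  have h1 : N₀ ^ 2 ≤ N ^ 2 := Nat.pow_le_pow_left hN 2
  calc n * N₀ ^ 2 ≤ (N + e) * N₀ ^ 2 := Nat.mul_le_mul_right _ hn
    _ = N * N₀ * N₀ + e * N₀ ^ 2 := by ring
    _ ≤ N * N₀ * N + e * N ^ 2 := by gcongr
    _ = (N₀ + e) * N ^ 2 := by ring

lemma Separated.of_le_two_mul {q l M₀ N n : ℕ} (h : Separated q l (M₀ + q) (2 * M₀))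
    (hM : 0 < M₀) (hqM : q ≤ M₀) (hN : M₀ + q ≤ N) (hn : n + 2 * q ≤ 2 * N) (hq : q ≤ 16 * l) :
    Separated q l N n := by
  refine h.mono (by omega) hN ?_ hq
  obtain ⟨d, rfl⟩ := Nat.exists_eq_add_of_le hN
  have h1 : n ≤ 2 * (M₀ + d) := by omega
  calc n * (M₀ + q) ^ 2 ≤ 2 * (M₀ + d) * (M₀ + q) ^ 2 := Nat.mul_le_mul_right _ h1
    _ ≤ 2 * M₀ * (M₀ + q + d) ^ 2 := by
      have h2 : d * (q * q) ≤ d * (M₀ * M₀) := by gcongr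
      nlinarith [Nat.zero_le (M₀ * d * d)]

/-- The binomial coefficient occurs in the term of index `2l` of the expansion of
`(2 + 1) ^ (3l)`. -/
lemma choose_three_mul_le (l : ℕ) : (3 * l).choose l * 4 ^ l ≤ 27 ^ l := by
  have h := add_pow (2 : ℕ) 1 (3 * l)
  simp only [Nat.cast_id] at h
  have h1 : 2 ^ (2 * l) * 1 ^ (3 * l - 2 * l) * (3 * l).choose (2 * l) ≤
      ∑ m ∈ Finset.range (3 * l + 1), 2 ^ m * 1 ^ (3 * l - m) * (3 * l).choose m :=
    Finset.single_le_sum (f := fun m => 2 ^ m * 1 ^ (3 * l - m) * (3 * l).choose m)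
      (fun _ _ => Nat.zero_le _) (Finset.mem_range.2 (by omega))
  rw [← h] at h1
  have h2 : (3 * l).choose (2 * l) = (3 * l).choose l := by
    rw [← Nat.choose_symm (by omega : l ≤ 3 * l)]
    congr 1
    omega
  rw [h2, one_pow, mul_one, pow_mul, pow_mul] at h1
  norm_num at h1
  linarith

lemma three_mul_choose_le {l q : ℕ} (hl : 1 ≤ l) (hq : q + 1 ≤ 3 * l) :
    3 * q.choose l * 4 ^ l ≤ 2 * 27 ^ l := by
  have h1 := Nat.choose_mul_succ_eq (3 * l - 1) l
  rw [show 3 * l - 1 + 1 = 3 * l by omega, show 3 * l - l = 2 * l by omega] at h1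
  have h2 : 3 * (3 * l - 1).choose l = 2 * (3 * l).choose l := by
    refine Nat.eq_of_mul_eq_mul_right hl ?_
    linarith
  have h3 : q.choose l ≤ (3 * l - 1).choose l := Nat.choose_le_choose l (by omega)
  calc 3 * q.choose l * 4 ^ l ≤ 3 * (3 * l - 1).choose l * 4 ^ l := by gcongr
    _ = 2 * ((3 * l).choose l * 4 ^ l) := by rw [h2]; ring
    _ ≤ 2 * 27 ^ l := Nat.mul_le_mul_left 2 (choose_three_mul_le l)

lemma two_pow_mul_factorial_le (l : ℕ) : 2 ^ l * l.factorial ≤ (l + 1) ^ l := by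
  induction l with
  | zero => simp
  | succ l ih =>
    have h1 : 2 * (l + 1) ^ (l + 1) ≤ (l + 1 + 1) ^ (l + 1) := by
      have h := one_add_mul_le_pow (R := ℝ) (a := 1 / (l + 1)) (by
        have : (0 : ℝ) ≤ 1 / (l + 1) := by positivity
        linarith) (l + 1)
      have hl : (0 : ℝ) < (l : ℝ) + 1 := by positivity
      rw [show (1 : ℝ) + 1 / (l + 1) = (l + 1 + 1) / (l + 1) by field_simp, div_pow,
        le_div_iff₀ (by positivity)] at h
      have h' : (1 + ((l + 1 : ℕ) : ℝ) * (1 / (l + 1))) = 2 := by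
        push_cast
        field_simp
        norm_num
      rw [h'] at h
      exact_mod_cast h
    rw [pow_succ, Nat.factorial_succ]
    calc 2 ^ l * 2 * ((l + 1) * l.factorial) = 2 * (l + 1) * (2 ^ l * l.factorial) := by ring
      _ ≤ 2 * (l + 1) * (l + 1) ^ l := Nat.mul_le_mul_left _ ih
      _ = 2 * (l + 1) ^ (l + 1) := by ring
      _ ≤ _ := h1

lemma pow_le_choose_mul (N l : ℕ) : (2 * (N + 1 - l)) ^ l ≤ N.choose l * (l + 1) ^ l := by
  have h1 := Nat.pow_sub_le_descFactorial N l
  rw [Nat.descFactorial_eq_factorial_mul_choose] at h1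
  calc (2 * (N + 1 - l)) ^ l = 2 ^ l * (N + 1 - l) ^ l := mul_pow _ _ _
    _ ≤ 2 ^ l * (l.factorial * N.choose l) := Nat.mul_le_mul_left _ h1
    _ = N.choose l * (2 ^ l * l.factorial) := by ring
    _ ≤ _ := Nat.mul_le_mul_left _ (two_pow_mul_factorial_le l)

lemma le_choose_of_mul_le {N l : ℕ} {t : ℝ} (ht : 0 ≤ t)
    (h : t * (l + 1) ≤ 2 * ((N : ℝ) + 1 - l)) :
    t ^ l ≤ N.choose l := by
  have hl : (0 : ℝ) < (l : ℝ) + 1 := by positivity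
  have h1 : (l : ℝ) ≤ N + 1 := by nlinarith
  have h2 : l ≤ N + 1 := by exact_mod_cast h1
  have h3 : ((2 * (N + 1 - l) : ℕ) : ℝ) ^ l ≤ N.choose l * ((l : ℝ) + 1) ^ l := by
    exact_mod_cast pow_le_choose_mul N l
  push_cast [Nat.cast_sub h2] at h3
  have h4 : (t * (l + 1)) ^ l ≤ N.choose l * ((l : ℝ) + 1) ^ l :=
    (pow_le_pow_left₀ (by positivity) h l).trans h3
  rw [mul_pow] at h4
  exact le_of_mul_le_mul_right h4 (by positivity)

/-- Separation for large `h` and the least admissible `q = ⌊3h / 2⌋ + 1`. With `s = √n` the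
hypotheses give `C(N, l) ≥ (4.29 s) ^ l`, while `C(q, l) ≤ (2 / 3) (27 / 4) ^ l`. -/
lemma separated_of_lt {n h q l N : ℕ} (hh : 13 ≤ h) (hn : 9 * h ^ 2 < 4 * n)
    (hl : l = h / 2 + 1) (hq : q + 1 ≤ 3 * l) (hN : n + 2 + l ≤ N + 1 + 2 * h) :
    Separated q l N n := by
  have hn381 : 381 ≤ n := by nlinarith
  have hn381' : (381 : ℝ) ≤ n := by exact_mod_cast hn381
  set s := Real.sqrt n with hs
  have hsn : s ^ 2 = n := Real.sq_sqrt (Nat.cast_nonneg n)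
  have hs0 : 0 ≤ s := Real.sqrt_nonneg _
  -- `h ≤ 2 s / 3` turns the size condition on `N` into a quadratic inequality for `s ≥ 39 / 2`.
  have hs1 : 39 / 2 ≤ s := by nlinarith
  have hhs : (h : ℝ) * 3 ≤ 2 * s := by
    have : (9 : ℝ) * h ^ 2 ≤ 4 * n := by exact_mod_cast hn.le
    nlinarith
  have hlh : (2 : ℝ) * l ≤ h + 2 := by exact_mod_cast (by omega : 2 * l ≤ h + 2)
  have hNr : (n : ℝ) + 2 + l ≤ N + 1 + 2 * h := by exact_mod_cast hN
  have hC : (429 / 100 * s) ^ l ≤ N.choose l := by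
    refine le_choose_of_mul_le (by positivity) ?_
    nlinarith
  have hc : (q.choose l : ℝ) ≤ 2 / 3 * (27 / 4) ^ l := by
    have h1 : (3 : ℝ) * q.choose l * 4 ^ l ≤ 2 * 27 ^ l := by
      exact_mod_cast three_mul_choose_le (by omega) hq
    rw [div_pow, mul_div_assoc', le_div_iff₀ (by positivity)]
    linarith
  have hbase : (n : ℝ) ^ 3 * (27 / 4) ^ 64 ≤ (429 / 100 * s) ^ 32 := by
    have h1 : (429 / 100 * s) ^ 32 = (429 / 100) ^ 32 * (n : ℝ) ^ 13 * n ^ 3 := by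
      rw [mul_pow, ← hsn]; ring
    have h2 : (27 / 4 : ℝ) ^ 64 ≤ (429 / 100) ^ 32 * 381 ^ 13 := by norm_num
    have h3 : (381 : ℝ) ^ 13 ≤ n ^ 13 := pow_le_pow_left₀ (by norm_num) hn381' 13
    rw [h1, mul_comm]
    refine mul_le_mul_of_nonneg_right (h2.trans ?_) (by positivity)
    exact mul_le_mul_of_nonneg_left h3 (by positivity)
  have hfin : (5 : ℝ) ^ 40 * n ^ q * q.choose l ^ 64 ≤ (4 * N.choose l) ^ 32 := by
    have hn1 : (1 : ℝ) ≤ n := by linarith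
    calc (5 : ℝ) ^ 40 * n ^ q * q.choose l ^ 64
        ≤ 5 ^ 40 * n ^ (3 * l) * (2 / 3 * (27 / 4) ^ l) ^ 64 := by
          gcongr
          omega
      _ = (5 ^ 40 * (2 / 3) ^ 64) * ((n : ℝ) ^ 3 * (27 / 4) ^ 64) ^ l := by
          rw [pow_mul, mul_pow, mul_pow, ← pow_mul, ← pow_mul, mul_comm l 64, pow_mul, pow_mul]
          ring
      _ ≤ 4 ^ 32 * ((429 / 100 * s) ^ 32) ^ l := by
          gcongr
          norm_num
      _ = (4 * (429 / 100 * s) ^ l) ^ 32 := by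
          rw [mul_pow 4, ← pow_mul, ← pow_mul, mul_comm 32 l]
      _ ≤ _ := by gcongr
  unfold Separated
  exact_mod_cast hfin

/-- Separation for large `h` and `q = 3h`. With `s = √n` the hypotheses give
`C(N, 2h) ≥ (3 s / 4) ^ (2h)`, while `C(3h, h) ≤ (27 / 4) ^ h`. -/
lemma separated_three_mul {n h N : ℕ} (hh : 8 ≤ h) (hn : 9 * h ^ 2 < 4 * n)
    (hN : n + 6 * h ≤ 2 * N) : Separated (3 * h) (2 * h) N n := by
  have hn145 : 145 ≤ n := by nlinarith
  have hn145' : (145 : ℝ) ≤ n := by exact_mod_cast hn145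
  set s := Real.sqrt n with hs
  have hsn : s ^ 2 = n := Real.sq_sqrt (Nat.cast_nonneg n)
  have hs0 : 0 ≤ s := Real.sqrt_nonneg _
  have hhs : (h : ℝ) * 3 ≤ 2 * s := by
    have : (9 : ℝ) * h ^ 2 ≤ 4 * n := by exact_mod_cast hn.le
    nlinarith
  have hNr : (n : ℝ) + 6 * h ≤ 2 * N := by exact_mod_cast hN
  have hC : (3 / 4 * s) ^ (2 * h) ≤ N.choose (2 * h) := by
    refine le_choose_of_mul_le (by positivity) ?_
    push_cast
    nlinarith
  have hc : ((3 * h).choose (2 * h) : ℝ) ≤ (27 / 4) ^ h := by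
    have h2 : (3 * h).choose (2 * h) = (3 * h).choose h := by
      rw [← Nat.choose_symm (by omega : h ≤ 3 * h)]
      congr 1
      omega
    have h1 : ((3 * h).choose h : ℝ) * 4 ^ h ≤ 27 ^ h := by
      exact_mod_cast choose_three_mul_le h
    rw [h2, div_pow, le_div_iff₀ (by positivity)]
    exact h1
  -- The factor `13 ^ h` with `h ≥ 8` absorbs the constant `5 ^ 40 / 4 ^ 32`.
  have hbase : 13 * ((n : ℝ) ^ 3 * (27 / 4) ^ 64) ≤ (3 / 4 * s) ^ 64 := by
    have h1 : (3 / 4 * s) ^ 64 = (3 / 4) ^ 64 * (n : ℝ) ^ 29 * n ^ 3 := by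
      rw [mul_pow, ← hsn]; ring
    have h2 : 13 * (27 / 4 : ℝ) ^ 64 ≤ (3 / 4) ^ 64 * 145 ^ 29 := by norm_num
    have h3 : (145 : ℝ) ^ 29 ≤ n ^ 29 := pow_le_pow_left₀ (by norm_num) hn145' 29
    rw [h1, mul_left_comm, mul_comm]
    refine mul_le_mul_of_nonneg_right (h2.trans ?_) (by positivity)
    exact mul_le_mul_of_nonneg_left h3 (by positivity)
  have hfin : (5 : ℝ) ^ 40 * n ^ (3 * h) * (3 * h).choose (2 * h) ^ 64 ≤
      (4 * N.choose (2 * h)) ^ 32 := by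
    have h5 : (5 : ℝ) ^ 40 ≤ 4 ^ 32 * 13 ^ 8 := by norm_num
    have h13 : (13 : ℝ) ^ 8 ≤ 13 ^ h := pow_le_pow_right₀ (by norm_num) hh
    calc (5 : ℝ) ^ 40 * n ^ (3 * h) * (3 * h).choose (2 * h) ^ 64
        ≤ (4 ^ 32 * 13 ^ 8) * (n : ℝ) ^ (3 * h) * ((27 / 4 : ℝ) ^ h) ^ 64 := by
          exact mul_le_mul (mul_le_mul_of_nonneg_right h5 (by positivity))
            (pow_le_pow_left₀ (Nat.cast_nonneg _) hc 64) (pow_nonneg (Nat.cast_nonneg _) _)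
            (by positivity)
      _ ≤ (4 ^ 32 * 13 ^ h) * (n : ℝ) ^ (3 * h) * ((27 / 4 : ℝ) ^ h) ^ 64 := by gcongr
      _ = 4 ^ 32 * (13 * ((n : ℝ) ^ 3 * (27 / 4) ^ 64)) ^ h := by
          rw [mul_pow, mul_pow, ← pow_mul, ← pow_mul, ← pow_mul, mul_comm h 64]
          ring
      _ ≤ 4 ^ 32 * ((3 / 4 * s) ^ 64) ^ h := by gcongr
      _ = (4 * (3 / 4 * s) ^ (2 * h)) ^ 32 := by
          rw [mul_pow 4, ← pow_mul, ← pow_mul]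
          ring
      _ ≤ _ := by gcongr
  unfold Separated
  exact_mod_cast hfin

/-- The family of the `q`-subsets of a set of size `N` defeats every estimator with error radius
`h` of a parameter of size `n`: for some bound `r` on the fraction of the family in a ball and
some tilt `B`, the hypothesis of the variational Fano inequality holds with divergence
`q log n / 40`. -/
def Defeats (q N n h : ℕ) : Prop :=
  ∃ r B : ℝ, 1 < B ∧ (ballBound N q h : ℝ) ≤ r * N.choose q ∧
    q * Real.log n / 40 + Real.log (1 + (B - 1) * r) ≤ 4 / 5 * Real.log B

lemma separated_iff {q l N n : ℕ} : Separated q l N n ↔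
    5 ^ 40 * n ^ q * (q.descFactorial l / l.factorial) ^ 64 ≤
      (4 * (N.descFactorial l / l.factorial)) ^ 32 := by
  rw [Separated, Nat.choose_eq_descFactorial_div_factorial,
    Nat.choose_eq_descFactorial_div_factorial]

lemma Separated.defeats {q l N n h : ℕ} (hS : Separated q l N n) (hl : l + h = q) (hqN : q ≤ N)
    (hn : 1 ≤ n) : Defeats q N n h := by
  have hc : 0 < q.choose l := Nat.choose_pos (by omega)
  have hC : 0 < N.choose l := Nat.choose_pos (by omega)
  have hcr : (0 : ℝ) < q.choose l := by exact_mod_cast hc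
  have hCr : (0 : ℝ) < N.choose l := by exact_mod_cast hC
  have hnr : (1 : ℝ) ≤ n := by exact_mod_cast hn
  set c : ℝ := (q.choose l : ℝ) with hcd
  set C : ℝ := (N.choose l : ℝ) with hCd
  have hSr : 5 ^ 40 * (n : ℝ) ^ q * c ^ 64 ≤ (4 * C) ^ 32 := by
    rw [hcd, hCd]; exact_mod_cast hS
  have hB : 5 ^ 40 * (n : ℝ) ^ q ≤ (4 * C / c ^ 2) ^ 32 := by
    rw [div_pow, le_div_iff₀ (by positivity), ← pow_mul]
    exact hSr
  have hB0 : 0 < 4 * C / c ^ 2 := by positivity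
  have hB1 : 1 < 4 * C / c ^ 2 := by
    by_contra! hle
    have h1 : (4 * C / c ^ 2) ^ 32 ≤ 1 := pow_le_one₀ hB0.le hle
    have h2 : (1 : ℝ) ≤ n ^ q := one_le_pow₀ hnr
    linarith
  refine ⟨c ^ 2 / C, 4 * C / c ^ 2, hB1, ?_, ?_⟩
  · have h1 : ballBound N q h ≤ q.choose l * (N - l).choose (q - l) := by
      refine (min_le_right _ _).trans (le_of_eq ?_)
      rw [show q - h = l by omega]
    have h2 : N.choose q * q.choose l = N.choose l * (N - l).choose (q - l) :=
      Nat.choose_mul (by omega)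
    have h1r : (ballBound N q h : ℝ) ≤ c * ((N - l).choose (q - l) : ℝ) := by
      rw [hcd]; exact_mod_cast h1
    have h2r : (N.choose q : ℝ) * c = C * ((N - l).choose (q - l) : ℝ) := by
      rw [hcd, hCd]; exact_mod_cast h2
    refine h1r.trans (le_of_eq ?_)
    field_simp
    linarith
  · have h1 : 1 + (4 * C / c ^ 2 - 1) * (c ^ 2 / C) = 5 - c ^ 2 / C := by
      field_simp
      ring
    have h2 : 0 < c ^ 2 / C := by positivity
    have h3 : c ^ 2 / C < 4 := by
      rw [lt_div_iff₀ (by positivity), one_mul] at hB1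
      rwa [div_lt_iff₀ hCr]
    have h4 : Real.log (5 - c ^ 2 / C) ≤ Real.log 5 :=
      Real.log_le_log (by linarith) (by linarith)
    have h5 := Real.log_le_log (by positivity) hB
    rw [Real.log_mul (by positivity) (by positivity), Real.log_pow, Real.log_pow,
      Real.log_pow] at h5
    push_cast at h5
    rw [h1]
    linarith

/-- For these sizes the union bound for the balls is too weak, and their exact count is used. -/
lemma defeats_five_three {n : ℕ} (hn : 21 ≤ n) (hn' : n ≤ 25) : Defeats 5 n n 3 := by
  refine ⟨(ballBound n 5 3 : ℝ) / n.choose 5, 8, by norm_num, ?_, ?_⟩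
  · have : (0 : ℝ) < n.choose 5 := by exact_mod_cast Nat.choose_pos (by omega : 5 ≤ n)
    rw [div_mul_cancel₀ _ this.ne']
  · have hC : 0 < n.choose 5 := Nat.choose_pos (by omega : 5 ≤ n)
    have hCr : (0 : ℝ) < n.choose 5 := by exact_mod_cast hC
    have key : n ^ 5 * (n.choose 5 + 7 * ballBound n 5 3) ^ 40 ≤ 8 ^ 32 * n.choose 5 ^ 40 := by
      have h1 : ballBound n 5 3 ≤ ∑ j ∈ Finset.range 4, Nat.choose 5 (5 - j) * (n - 5).choose j :=
        min_le_left _ _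
      refine (Nat.mul_le_mul_left _ (Nat.pow_le_pow_left (Nat.add_le_add_left
        (Nat.mul_le_mul_left 7 h1) _) 40)).trans ?_
      interval_cases n <;>
        simp only [Finset.sum_range_succ, Finset.sum_range_zero] <;>
        norm_num [Nat.choose_eq_descFactorial_div_factorial, Nat.descFactorial, Nat.factorial]
    have keyr : (n : ℝ) ^ 5 * (n.choose 5 + 7 * ballBound n 5 3) ^ 40 ≤
        8 ^ 32 * (n.choose 5) ^ 40 := by exact_mod_cast key
    have hb : (0 : ℝ) ≤ ballBound n 5 3 := Nat.cast_nonneg _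
    have hn0 : (0 : ℝ) < n := by exact_mod_cast (by omega : 0 < n)
    have h2 : (n : ℝ) ^ 5 * (1 + (8 - 1) * ((ballBound n 5 3 : ℝ) / n.choose 5)) ^ 40 ≤
        8 ^ 32 := by
      have h3 : 1 + (8 - 1) * ((ballBound n 5 3 : ℝ) / n.choose 5) =
          (n.choose 5 + 7 * ballBound n 5 3) / n.choose 5 := by
        field_simp
        ring
      rw [h3, div_pow, ← mul_div_assoc, div_le_iff₀ (by positivity)]
      exact keyr
    have h4 : (0 : ℝ) < 1 + (8 - 1) * ((ballBound n 5 3 : ℝ) / n.choose 5) := by positivity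
    have h5 := Real.log_le_log (by positivity) h2
    rw [Real.log_mul (by positivity) (by positivity), Real.log_pow, Real.log_pow,
      Real.log_pow] at h5
    push_cast at h5 ⊢
    linarith

/-- Let `k` be the size of the smaller one of the top set and its complement. Some `q ≤ k` makes
the family of the `q`-subsets of a set of size `n - k + q` large enough. For `h ≥ 4` the choice is
`q = 3h` if `k` allows it and `q = ⌊3h / 2⌋ + 1`, the least size the hypotheses always allow,
otherwise. -/
lemma exists_defeats {n k h : ℕ} (hn : 20 ≤ n) (hk : 2 * k ≤ n) (hhk : 3 * h < 2 * k)
    (hhn : 9 * h ^ 2 < 4 * n) : ∃ q, 1 ≤ q ∧ q ≤ k ∧ Defeats q (n - k + q) n h := by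
  have aux : ∀ q l, Separated q l (n - k + q) n → l + h = q → 1 ≤ q → q ≤ k →
      ∃ q, 1 ≤ q ∧ q ≤ k ∧ Defeats q (n - k + q) n h := fun q l hS hl hq1 hqk =>
    ⟨q, hq1, hqk, hS.defeats hl (by omega) (by omega)⟩
  -- The size `N = n - k + q` is at least `n - e` when `k` is bounded, and at least `n / 2 + q`
  -- always; either way it is enough to check the least `N` allowed by the hypotheses.
  have auxAdd : ∀ q l N₀ e, Separated q l N₀ (N₀ + e) →
      l + h = q ∧ 1 ≤ q ∧ q ≤ k ∧ 0 < N₀ ∧ N₀ ≤ n - k + q ∧ n ≤ n - k + q + e ∧ q ≤ 16 * l →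
      ∃ q, 1 ≤ q ∧ q ≤ k ∧ Defeats q (n - k + q) n h :=
    fun q l N₀ e hS ⟨hl, hq1, hqk, h0, hN, hne, hql⟩ =>
      aux q l (hS.of_le_add e h0 hN hne hql) hl hq1 hqk
  have auxTwo : ∀ q l M₀, Separated q l (M₀ + q) (2 * M₀) →
      l + h = q ∧ 1 ≤ q ∧ q ≤ k ∧ 0 < M₀ ∧ q ≤ M₀ ∧ M₀ + q ≤ n - k + q ∧
        n + 2 * q ≤ 2 * (n - k + q) ∧ q ≤ 16 * l →
      ∃ q, 1 ≤ q ∧ q ≤ k ∧ Defeats q (n - k + q) n h :=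
    fun q l M₀ hS ⟨hl, hq1, hqk, h0, hqM, hN, hne, hql⟩ =>
      aux q l (hS.of_le_two_mul h0 hqM hN hne hql) hl hq1 hqk
  rcases Nat.lt_or_ge h 8 with hh8 | hh8
  · interval_cases h
    · exact auxTwo 1 1 10 (by norm_num [separated_iff, Nat.descFactorial, Nat.factorial])
        (by omega)
    · exact auxTwo 2 1 10 (by norm_num [separated_iff, Nat.descFactorial, Nat.factorial])
        (by omega)
    · rcases Nat.lt_or_ge k 6 with hk6 | hk6
      · exact auxAdd 4 2 19 1 (by norm_num [separated_iff, Nat.descFactorial, Nat.factorial])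
          (by omega)
      · exact auxTwo 6 4 10 (by norm_num [separated_iff, Nat.descFactorial, Nat.factorial])
          (by omega)
    · rcases Nat.lt_or_ge k 9 with hk9 | hk9
      · have hk5 : 5 ≤ k := by omega
        have hN : n - k + k = n := by omega
        interval_cases k
        · rcases Nat.lt_or_ge n 26 with hn26 | hn26
          · refine ⟨5, by omega, by omega, ?_⟩
            rw [hN]
            exact defeats_five_three (by omega) (by omega)
          · exact auxAdd 5 2 26 0 (by norm_num [separated_iff, Nat.descFactorial, Nat.factorial])
              (by omega)
        · exact auxAdd 6 3 21 0 (by norm_num [separated_iff, Nat.descFactorial, Nat.factorial])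
            (by omega)
        · exact auxAdd 7 4 21 0 (by norm_num [separated_iff, Nat.descFactorial, Nat.factorial])
            (by omega)
        · exact auxAdd 8 5 21 0 (by norm_num [separated_iff, Nat.descFactorial, Nat.factorial])
            (by omega)
      · exact auxTwo 9 6 11 (by norm_num [separated_iff, Nat.descFactorial, Nat.factorial])
          (by omega)
    · rcases Nat.lt_or_ge k 12 with hk' | hk'
      · exact auxAdd 7 3 33 4 (by norm_num [separated_iff, Nat.descFactorial, Nat.factorial])
          (by omega)
      · exact auxTwo 12 8 19 (by norm_num [separated_iff, Nat.descFactorial, Nat.factorial])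
          (by omega)
    · rcases Nat.lt_or_ge k 15 with hk' | hk'
      · exact auxAdd 8 3 51 6 (by norm_num [separated_iff, Nat.descFactorial, Nat.factorial])
          (by omega)
      · exact auxTwo 15 10 29 (by norm_num [separated_iff, Nat.descFactorial, Nat.factorial])
          (by omega)
    · rcases Nat.lt_or_ge k 18 with hk' | hk'
      · exact auxAdd 10 4 75 7 (by norm_num [separated_iff, Nat.descFactorial, Nat.factorial])
          (by omega)
      · exact auxTwo 18 12 41 (by norm_num [separated_iff, Nat.descFactorial, Nat.factorial])
          (by omega)
    · rcases Nat.lt_or_ge k 21 with hk' | hk'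
      · exact auxAdd 11 4 102 9 (by norm_num [separated_iff, Nat.descFactorial, Nat.factorial])
          (by omega)
      · exact auxTwo 21 14 56 (by norm_num [separated_iff, Nat.descFactorial, Nat.factorial])
          (by omega)
  rcases Nat.lt_or_ge k (3 * h) with hk3 | hk3
  · rcases Nat.lt_or_ge h 13 with hh13 | hh13
    · interval_cases h
      · exact auxAdd 13 5 135 10 (by norm_num [separated_iff, Nat.descFactorial, Nat.factorial])
          (by omega)
      · exact auxAdd 14 5 171 12 (by norm_num [separated_iff, Nat.descFactorial, Nat.factorial])
          (by omega)
      · exact auxAdd 16 6 213 13 (by norm_num [separated_iff, Nat.descFactorial, Nat.factorial])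
          (by omega)
      · exact auxAdd 17 6 258 15 (by norm_num [separated_iff, Nat.descFactorial, Nat.factorial])
          (by omega)
      · exact auxAdd 19 7 309 16 (by norm_num [separated_iff, Nat.descFactorial, Nat.factorial])
          (by omega)
    · exact aux (3 * h / 2 + 1) (h / 2 + 1)
        (separated_of_lt hh13 hhn rfl (by omega) (by omega)) (by omega) (by omega) (by omega)
  · exact aux (3 * h) (2 * h) (separated_three_mul hh8 hhn (by omega)) (by omega) (by omega) hk3

namespace TopKChoice

/-! ### Divergence of the data laws -/

/-- A bound for the total divergence over all menus, common to adding `q` items to the top set and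
to removing `q` items from it. It is stated in terms of `x = δ / v`, of the score `a` of a top
item, and of the lower bound `(1 - 1 / m) x / (1 + x)` of `bordaScore_gap` for the relative gap. -/
noncomputable def divBound (n m q : ℕ) (x a : ℝ) : ℝ :=
  q * ((n - 1).choose (m - 1) * a) * (12 / 5 * ((1 - 1 / (m : ℝ)) * (x / (1 + x))) ^ 2)

lemma choose_pred_mul_bordaScore {n m : ℕ} (M : MNL n) (hm : 1 ≤ m) (hmn : m ≤ n) (i : Fin n) :
    ((n - 1).choose (m - 1) : ℝ) * bordaScore M.choice m i = M.weight i * invSum M m i := by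
  have h : (0 : ℝ) < ((n - 1).choose (m - 1) : ℝ) := by
    exact_mod_cast Nat.choose_pos (by omega : m - 1 ≤ n - 1)
  rw [bordaScore_eq, mul_div_cancel₀ _ h.ne']

/-- Adding `A` to the top set `C`: the divergences add up to `|A|` copies of the score of a top
item. -/
lemma sum_menuDiv_raise_le {n K m q : ℕ} {v δ : ℝ} (hδ : 0 < δ) (hδv : δ < v) (hm : 2 ≤ m)
    (hmn : m ≤ n) (S : KSubset n K) {C A : Finset (Fin n)} (hS : S.1 = C ∪ A)
    (hCA : Disjoint C A) (hA : A.card = q) {i : Fin n} (hi : i ∈ S.1) :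
    ∑ U : Menu n m, menuDiv (twoLevel v δ hδ hδv S)
      (twoLevel v δ hδ hδv (⟨C, rfl⟩ : KSubset n C.card)) U.1 ≤
      divBound n m q (δ / v) (bordaScore (twoLevel v δ hδ hδv S).choice m i) := by
  have hv : 0 < v := hδ.trans hδv
  set x := δ / v with hx
  have hx0 : 0 < x := by positivity
  have hx1 : x ≤ 1 := by rw [hx, div_le_one hv]; exact hδv.le
  have hm2 : (2 : ℝ) ≤ m := by exact_mod_cast hm
  set φ := (1 + x) * Real.log (1 + x) - x - x ^ 2 * (1 / (m : ℝ)) / (2 * (1 + x)) with hφ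
  have hnum : (1 + x) * φ ≤ 12 / 5 * (1 - 1 / (m : ℝ)) ^ 2 * x ^ 2 :=
    raise_const_le hx0.le hx1 (one_div_le_one_div_of_le two_pos hm2)
  have hnotMem : ∀ k ∈ A, k ∉ C := fun k hk hkC => Finset.disjoint_left.1 hCA hkC hk
  have h1 : ∀ U ∈ (Finset.univ : Finset (Menu n m)), menuDiv (twoLevel v δ hδ hδv S)
      (twoLevel v δ hδ hδv (⟨C, rfl⟩ : KSubset n C.card)) U.1 ≤
      ((U.1 ∩ A).card : ℝ) * (1 / ∑ k ∈ U.1, (twoLevel v δ hδ hδv S).weight k) * (v * φ) := by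
    intro U _
    have hU : U.1.Nonempty := Finset.card_pos.1 (by rw [U.2]; omega)
    have h := menuDiv_raise_le (twoLevel v δ hδ hδv S)
      (twoLevel v δ hδ hδv (⟨C, rfl⟩ : KSubset n C.card)) (A := A) hU hv hδ
      (fun k hk => twoLevel_weight_of_notMem hδ hδv (hnotMem k hk))
      (fun k => by
        by_cases hkA : k ∈ A
        · simp [twoLevel, hS, hkA, hnotMem k hkA]
        · simp [twoLevel, hS, hkA])
      (fun k => by simp only [twoLevel]; split_ifs <;> linarith)
    rw [U.2] at h
    refine h.trans (le_of_eq ?_)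
    rw [hφ]
    ring
  refine (Finset.sum_le_sum h1).trans ?_
  rw [← Finset.sum_mul, sum_menu_card_inter]
  have h2 : ∀ k ∈ A, invSum (twoLevel v δ hδ hδv S) m k = invSum (twoLevel v δ hδ hδv S) m i :=
    fun k hk => invSum_twoLevel_eq hδ hδv m S S
      (iff_of_true hi (by rw [hS]; exact Finset.mem_union_right _ hk))
  rw [Finset.sum_congr rfl h2, Finset.sum_const, hA, nsmul_eq_mul, divBound,
    choose_pred_mul_bordaScore _ (by omega) hmn, twoLevel_weight_of_mem hδ hδv hi]
  have hT := invSum_pos (twoLevel v δ hδ hδv S) (by omega : 1 ≤ m) hmn i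
  set T := invSum (twoLevel v δ hδ hδv S) m i
  have hδx : v + δ = v * (1 + x) := by rw [hx]; field_simp
  have h3 : (q : ℝ) * ((v + δ) * T) * (12 / 5 * ((1 - 1 / (m : ℝ)) * (x / (1 + x))) ^ 2) =
      q * T * v * (12 / 5 * (1 - 1 / (m : ℝ)) ^ 2 * x ^ 2 / (1 + x)) := by
    rw [hδx]
    field_simp
  rw [h3]
  have h4 : φ ≤ 12 / 5 * (1 - 1 / (m : ℝ)) ^ 2 * x ^ 2 / (1 + x) := by
    rw [le_div_iff₀ (by positivity)]
    linarith
  calc (q : ℝ) * T * (v * φ) = q * T * v * φ := by ring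
    _ ≤ _ := mul_le_mul_of_nonneg_left h4 (by positivity)

/-- Removing `A` from the top set `G`: the divergences add up to `|A|` copies of the score of an
item outside the top set, which the gap bounds by a multiple of the score of a top item. -/
lemma sum_menuDiv_lower_le {n K m q : ℕ} {v δ : ℝ} (hδ : 0 < δ) (hδv : δ < v) (hm : 2 ≤ m)
    (hmn : m ≤ n) (S : KSubset n K) {G A : Finset (Fin n)} (hS : S.1 = G \ A)
    (hAG : A ⊆ G) (hA : A.card = q) {i j : Fin n} (hi : i ∈ S.1) (hj : j ∉ S.1) :
    ∑ U : Menu n m, menuDiv (twoLevel v δ hδ hδv S)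
      (twoLevel v δ hδ hδv (⟨G, rfl⟩ : KSubset n G.card)) U.1 ≤
      divBound n m q (δ / v) (bordaScore (twoLevel v δ hδ hδv S).choice m i) := by
  have hv : 0 < v := hδ.trans hδv
  have hgap := bordaScore_gap hδ hδv (by omega : 1 ≤ m) hi hj
  have hb := choose_pred_mul_bordaScore (twoLevel v δ hδ hδv S) (by omega : 1 ≤ m) hmn j
  set x := δ / v with hx
  have hx0 : 0 < x := by positivity
  have hx1 : x ≤ 1 := by rw [hx, div_le_one hv]; exact hδv.le
  have hm2 : (2 : ℝ) ≤ m := by exact_mod_cast hm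
  have hy0 : (0 : ℝ) ≤ 1 / m := by positivity
  have hy := one_div_le_one_div_of_le two_pos hm2
  have hC : (0 : ℝ) ≤ ((n - 1).choose (m - 1) : ℝ) := Nat.cast_nonneg _
  have hnum := lower_const_le hx0.le hx1 hy0 hy
  set y : ℝ := 1 / (m : ℝ) with hyd
  set φ := x - Real.log (1 + x) - 3 * x ^ 2 * y / (6 + (6 - 2 * y) * x) with hφ
  have hAS : ∀ k ∈ A, k ∉ S.1 := fun k hk => by simp [hS, hk]
  have h1 : ∀ U ∈ (Finset.univ : Finset (Menu n m)), menuDiv (twoLevel v δ hδ hδv S)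
      (twoLevel v δ hδ hδv (⟨G, rfl⟩ : KSubset n G.card)) U.1 ≤
      ((U.1 ∩ A).card : ℝ) * (1 / ∑ k ∈ U.1, (twoLevel v δ hδ hδv S).weight k) * (v * φ) := by
    intro U _
    have hU : U.1.Nonempty := Finset.card_pos.1 (by rw [U.2]; omega)
    have h := menuDiv_lower_le (twoLevel v δ hδ hδv S)
      (twoLevel v δ hδ hδv (⟨G, rfl⟩ : KSubset n G.card)) (A := A) hU hv hδ
      (fun k hk => twoLevel_weight_of_notMem hδ hδv (hAS k hk))
      (fun k => by
        by_cases hkA : k ∈ A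
        · simp [twoLevel, hS, hkA, hAG hkA]
        · simp [twoLevel, hS, hkA])
      (fun k => by simp only [twoLevel]; split_ifs <;> linarith)
    rw [U.2] at h
    refine h.trans (le_of_eq ?_)
    rw [hφ, hyd]
    ring
  refine (Finset.sum_le_sum h1).trans ?_
  rw [← Finset.sum_mul, sum_menu_card_inter]
  have h2 : ∀ k ∈ A, invSum (twoLevel v δ hδ hδv S) m k = invSum (twoLevel v δ hδ hδv S) m j :=
    fun k hk => invSum_twoLevel_eq hδ hδv m S S (by simp [hj, hAS k hk])
  rw [Finset.sum_congr rfl h2, Finset.sum_const, hA, nsmul_eq_mul, divBound]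
  rw [twoLevel_weight_of_notMem hδ hδv hj] at hb
  have hbpos := bordaScore_pos (twoLevel v δ hδ hδv S) (by omega : 1 ≤ m) hmn j
  set a := bordaScore (twoLevel v δ hδ hδv S).choice m i
  set b := bordaScore (twoLevel v δ hδ hδv S).choice m j
  set c : ℝ := ((n - 1).choose (m - 1) : ℝ)
  have hxv : δ / (v + δ) = x / (1 + x) := by rw [hx]; field_simp
  rw [hxv] at hgap
  have hba : b ≤ a * ((1 + x * y) / (1 + x)) := by
    have : a * ((1 + x * y) / (1 + x)) = a - (1 - y) * (x / (1 + x)) * a := by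
      field_simp
      ring
    linarith
  have h4 : φ ≤ 12 / 5 * (1 - y) ^ 2 * x ^ 2 / ((1 + x) * (1 + x * y)) := by
    rw [le_div_iff₀ (by positivity)]
    linarith
  have hqc : 0 ≤ (q : ℝ) * c := mul_nonneg (Nat.cast_nonneg _) hC
  calc (q : ℝ) * invSum (twoLevel v δ hδ hδv S) m j * (v * φ) = q * c * b * φ := by
        rw [mul_assoc (q : ℝ) c b, hb]; ring
    _ ≤ q * c * b * (12 / 5 * (1 - y) ^ 2 * x ^ 2 / ((1 + x) * (1 + x * y))) :=
        mul_le_mul_of_nonneg_left h4 (mul_nonneg hqc hbpos.le)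
    _ ≤ q * c * (a * ((1 + x * y) / (1 + x))) *
          (12 / 5 * (1 - y) ^ 2 * x ^ 2 / ((1 + x) * (1 + x * y))) :=
        mul_le_mul_of_nonneg_right (mul_le_mul_of_nonneg_left hba hqc) (by positivity)
    _ = q * (c * a) * (12 / 5 * ((1 - y) * (x / (1 + x))) ^ 2) := by
        field_simp

/-- The bound on the expected number of offers turns the bound on the divergences into
`q log n / 40`. -/
lemma mul_divBound_le {n m q : ℕ} {x a Δ X : ℝ} (hm : 2 ≤ m) (hmn : m ≤ n) (hx : 0 < x)
    (ha : 0 < a) (hgap : (1 - 1 / (m : ℝ)) * (x / (1 + x)) * a ≤ Δ)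
    (hX : X * (n.choose m : ℝ) ≤ 1 / 96 * (n * Real.log n / (m * Δ)) * (a / Δ)) :
    X * divBound n m q x a ≤ q * Real.log n / 40 := by
  have hm2 : (2 : ℝ) ≤ m := by exact_mod_cast hm
  have hm0 : (0 : ℝ) < m := by linarith
  have hn0 : (0 : ℝ) < n := by exact_mod_cast (by omega : 0 < n)
  have hL : 0 ≤ Real.log n := Real.log_natCast_nonneg n
  have hy : 1 / (m : ℝ) ≤ 1 / 2 := one_div_le_one_div_of_le two_pos hm2
  set g := (1 - 1 / (m : ℝ)) * (x / (1 + x)) with hg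
  have hg0 : 0 < g := mul_pos (by linarith) (by positivity)
  have hΔ : 0 < Δ := lt_of_lt_of_le (mul_pos hg0 ha) hgap
  have hchoose : (m : ℝ) * n.choose m = n * (n - 1).choose (m - 1) := by
    obtain ⟨n', rfl⟩ : ∃ n', n = n' + 1 := ⟨n - 1, by omega⟩
    obtain ⟨m', rfl⟩ : ∃ m', m = m' + 1 := ⟨m - 1, by omega⟩
    have h := congrArg (Nat.cast (R := ℝ)) (Nat.add_one_mul_choose_eq n' m')
    push_cast at h
    simp only [Nat.add_sub_cancel]
    push_cast
    linarith
  have h1 : X * ((n - 1).choose (m - 1) : ℝ) ≤ Real.log n * a / (96 * Δ ^ 2) := by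
    have h2 : X * ((n - 1).choose (m - 1) : ℝ) = X * n.choose m * (m / n) := by
      have : ((n - 1).choose (m - 1) : ℝ) = m * n.choose m / n := by
        rw [hchoose]; field_simp
      rw [this]; ring
    rw [h2]
    refine (mul_le_mul_of_nonneg_right hX (by positivity)).trans (le_of_eq ?_)
    field_simp
  have h3 : (g * a) ^ 2 ≤ Δ ^ 2 := pow_le_pow_left₀ (mul_pos hg0 ha).le hgap 2
  calc X * divBound n m q x a
      = X * ((n - 1).choose (m - 1) : ℝ) * (q * a * (12 / 5 * g ^ 2)) := by
        rw [divBound, ← hg]; ring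
    _ ≤ Real.log n * a / (96 * Δ ^ 2) * (q * a * (12 / 5 * g ^ 2)) :=
        mul_le_mul_of_nonneg_right h1 (by positivity)
    _ = q * Real.log n / 40 * ((g * a) ^ 2 / Δ ^ 2) := by
        field_simp
        ring
    _ ≤ q * Real.log n / 40 * 1 := by
        refine mul_le_mul_of_nonneg_left ?_ (by positivity)
        rw [div_le_one (by positivity)]
        exact h3
    _ = q * Real.log n / 40 := mul_one _

/-! ### The lower bound -/

lemma twoLevel_isTop {n K : ℕ} {v δ : ℝ} (hδ : 0 < δ) (hδv : δ < v) (S : KSubset n K) :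
    (twoLevel v δ hδ hδv S).IsTop S := by
  intro i hi j hj
  rw [twoLevel_weight_of_mem hδ hδv hi, twoLevel_weight_of_notMem hδ hδv hj]
  linarith

/-- Fano's inequality for a family indexed by the `q`-subsets of `G` whose balls in the edit
distance are balls of `q`-subsets. -/
lemma exists_errorProb_ge_of_powersetCard {n m R K q h : ℕ} (hm : 1 ≤ m) {p : ℝ} (hp0 : 0 ≤ p)
    (hp1 : p ≤ 1) (est : Estimator n m R K) (G : Finset (Fin n)) (hqG : q ≤ G.card)
    (hdef : Defeats q G.card n h) (S : {A // A ∈ G.powersetCard q} → KSubset n K)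
    (M : {A // A ∈ G.powersetCard q} → MNL n) (M₀ : MNL n)
    (hI : ∀ A, p * R * ∑ U : Menu n m, menuDiv (M A) M₀ U.1 ≤ q * Real.log n / 40)
    (hball : ∀ T : KSubset n K, ∃ T' ⊆ G, T'.card = q ∧
      ∀ A : {A // A ∈ G.powersetCard q}, (A.1 \ T').card ≤ editDist T (S A)) :
    ∃ A, 1 / 5 ≤ errorProb (M A).choice p est h (S A) := by
  obtain ⟨r, B, hB, hr, hmain⟩ := hdef
  have hne : (G.powersetCard q).attach.Nonempty :=
    Finset.attach_nonempty_iff.2 (Finset.powersetCard_nonempty.2 hqG)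
  obtain ⟨A, -, hA⟩ := exists_errorProb_ge (G.powersetCard q).attach hne hm hp0 hp1 est h S M M₀
    (fun A _ => hI A) (r := r) (fun T => by
      obtain ⟨T', hT'G, hT'q, hT'⟩ := hball T
      rw [Finset.card_attach, Finset.card_powersetCard]
      refine le_trans ?_ hr
      have hcard := card_ball_le_ballBound hT'G h
      rw [hT'q] at hcard
      refine Nat.cast_le.2 (le_trans ?_ hcard)
      refine Finset.card_le_card_of_injOn Subtype.val (fun A hA => ?_)
        Subtype.val_injective.injOn
      have hA' := (Finset.mem_filter.1 hA).2
      exact Finset.mem_filter.2 ⟨A.2, (hT' A).trans hA'⟩) hB hmain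
  exact ⟨A, hA⟩

end TopKChoice

theorem mainTheorem2 (n m K h : ℕ) (hn : 20 ≤ n) (hm : 2 ≤ m) (hmn : m ≤ n)
    (hh : (h : ℝ) < 2 / 3 * min (K : ℝ) (min (Real.sqrt n) ((n : ℝ) - K)))
    (v δ : ℝ) (hδ : 0 < δ) (hδv : δ < v) (S₀ : TopKChoice.KSubset n K)
    (p : ℝ) (hp0 : 0 ≤ p) (hp1 : p ≤ 1) (R : ℕ)
    (hpR : p * R * (n.choose m : ℝ) ≤
      1 / 96 *
        (n * Real.log n /
          (m * TopKChoice.gap (TopKChoice.twoLevel v δ hδ hδv S₀).choice m K h)) *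
        (TopKChoice.tau (TopKChoice.twoLevel v δ hδ hδv S₀).choice m (K - h) /
          TopKChoice.gap (TopKChoice.twoLevel v δ hδ hδv S₀).choice m K h))
    (est : TopKChoice.Estimator n m R K) :
    ∃ S : TopKChoice.KSubset n K,
      (TopKChoice.twoLevel v δ hδ hδv S).IsTop S ∧
      1 / 5 ≤ TopKChoice.errorProb (TopKChoice.twoLevel v δ hδ hδv S).choice p est h S := by
  have hv : 0 < v := hδ.trans hδv
  have hm1 : 1 ≤ m := by omega
  have hh1 := min_le_left (K : ℝ) (min (Real.sqrt n) ((n : ℝ) - K))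
  have hh2 := (min_le_right (K : ℝ) (min (Real.sqrt n) ((n : ℝ) - K))).trans (min_le_left _ _)
  have hh3 := (min_le_right (K : ℝ) (min (Real.sqrt n) ((n : ℝ) - K))).trans (min_le_right _ _)
  have hhK : 3 * h < 2 * K := by
    have : (3 : ℝ) * h < 2 * K := by linarith
    exact_mod_cast this
  have hhnK : 3 * h + 2 * K < 2 * n := by
    have : (3 : ℝ) * h + 2 * K < 2 * n := by linarith
    exact_mod_cast this
  have hhn : 9 * h ^ 2 < 4 * n := by
    have h1 : (3 : ℝ) * h < 2 * Real.sqrt n := by linarith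
    have h2 : (Real.sqrt n) ^ 2 = n := Real.sq_sqrt (Nat.cast_nonneg n)
    have h3 : (0 : ℝ) ≤ h := Nat.cast_nonneg h
    have h4 : (9 : ℝ) * h ^ 2 < 4 * n := by nlinarith
    exact_mod_cast h4
  -- The scores of the model with top set `S₀`, which are those of all the other models.
  obtain ⟨i₀, hi₀⟩ : S₀.1.Nonempty := Finset.card_pos.1 (by rw [S₀.2]; omega)
  obtain ⟨j₀, hj₀⟩ : ∃ j, j ∉ S₀.1 := by
    by_contra! hall
    have h1 := Finset.card_le_card (fun j _ => hall j : (Finset.univ : Finset (Fin n)) ⊆ S₀.1)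
    rw [S₀.2, Finset.card_univ, Fintype.card_fin] at h1
    omega
  obtain ⟨htop, hbot⟩ := TopKChoice.tau_twoLevel hδ hδv hm hmn S₀ hi₀ hj₀
  rw [TopKChoice.gap, htop (K - h) (by omega) (by omega),
    hbot (K + h + 1) (by omega) (by omega)] at hpR
  have hgap := TopKChoice.bordaScore_gap hδ hδv hm1 hi₀ hj₀
  rw [show δ / (v + δ) = δ / v / (1 + δ / v) by field_simp] at hgap
  have ha := TopKChoice.bordaScore_pos (TopKChoice.twoLevel v δ hδ hδv S₀) hm1 hmn i₀
  have hinfo : ∀ (q : ℕ) (S : TopKChoice.KSubset n K) (i : Fin n), i ∈ S.1 → ∀ D : ℝ,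
      D ≤ TopKChoice.divBound n m q (δ / v)
        (TopKChoice.bordaScore (TopKChoice.twoLevel v δ hδ hδv S).choice m i) →
      p * R * D ≤ q * Real.log n / 40 := by
    intro q S i hi D hD
    rw [TopKChoice.bordaScore_twoLevel_eq hδ hδv m S₀ S (by simp [hi, hi₀] : i₀ ∈ S₀.1 ↔ i ∈ S.1)]
      at hD
    exact (mul_le_mul_of_nonneg_left hD (by positivity)).trans
      (TopKChoice.mul_divBound_le hm hmn (by positivity) ha hgap hpR)
  rcases Nat.le_total (2 * K) n with hKn | hKn
  · -- The top sets `Gᶜ ∪ A` are compared with the model whose top set is `Gᶜ`.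
    obtain ⟨q, hq1, hqK, hdef⟩ := exists_defeats hn hKn hhK hhn
    obtain ⟨G, -, hG⟩ := Finset.exists_subset_card_eq
      (s := (Finset.univ : Finset (Fin n))) (n := n - K + q) (by simp; omega)
    have hGc : Gᶜ.card + q = K := by
      rw [Finset.card_compl, Fintype.card_fin, hG]; omega
    have hmem : ∀ A : {A // A ∈ G.powersetCard q}, A.1 ⊆ G ∧ A.1.card = q :=
      fun A => Finset.mem_powersetCard.1 A.2
    have hdisj : ∀ A : {A // A ∈ G.powersetCard q}, Disjoint Gᶜ A.1 := fun A =>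
      Finset.disjoint_left.2 fun x hx hxA => (Finset.mem_compl.1 hx) ((hmem A).1 hxA)
    set S : {A // A ∈ G.powersetCard q} → TopKChoice.KSubset n K := fun A =>
      ⟨Gᶜ ∪ A.1, by rw [Finset.card_union_of_disjoint (hdisj A), (hmem A).2, hGc]⟩ with hS
    obtain ⟨A, hA⟩ := TopKChoice.exists_errorProb_ge_of_powersetCard hm1 hp0 hp1 est G
      (by omega) (by rw [hG]; exact hdef) S (fun A => TopKChoice.twoLevel v δ hδ hδv (S A))
      (TopKChoice.twoLevel v δ hδ hδv ⟨Gᶜ, rfl⟩)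
      (fun A => by
        obtain ⟨i, hi⟩ : (S A).1.Nonempty := Finset.card_pos.1 (by rw [(S A).2]; omega)
        exact hinfo q (S A) i hi _ (TopKChoice.sum_menuDiv_raise_le hδ hδv hm hmn (S A) rfl
          (hdisj A) (hmem A).2 hi))
      (fun T => by
        obtain ⟨T', hT'G, hT'q, hT'⟩ := exists_core_of_card_eq G T.1 q (by rw [T.2, hGc])
        refine ⟨T', hT'G, hT'q, fun A => (hT' A.1 (hmem A).1).trans (le_of_eq ?_)⟩
        exact Finset.card_sdiff_comm ((S A).2.trans T.2.symm))
    exact ⟨S A, TopKChoice.twoLevel_isTop hδ hδv _, hA⟩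
  · -- The top sets `G \ A` are compared with the model whose top set is `G`; passing to
    -- complements turns the balls into those of the other case.
    obtain ⟨q, hq1, hqK, hdef⟩ := exists_defeats (k := n - K) hn (by omega) (by omega) hhn
    obtain ⟨G, -, hG⟩ := Finset.exists_subset_card_eq
      (s := (Finset.univ : Finset (Fin n))) (n := K + q) (by simp; omega)
    have hGc : Gᶜ.card + q = n - K := by
      rw [Finset.card_compl, Fintype.card_fin, hG]; omega
    rw [show n - (n - K) + q = G.card by omega] at hdef
    have hmem : ∀ A : {A // A ∈ G.powersetCard q}, A.1 ⊆ G ∧ A.1.card = q :=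
      fun A => Finset.mem_powersetCard.1 A.2
    set S : {A // A ∈ G.powersetCard q} → TopKChoice.KSubset n K := fun A =>
      ⟨G \ A.1, by rw [Finset.card_sdiff_of_subset (hmem A).1, (hmem A).2, hG]; omega⟩ with hS
    obtain ⟨A, hA⟩ := TopKChoice.exists_errorProb_ge_of_powersetCard hm1 hp0 hp1 est G
      (by omega) hdef S (fun A => TopKChoice.twoLevel v δ hδ hδv (S A))
      (TopKChoice.twoLevel v δ hδ hδv ⟨G, rfl⟩)
      (fun A => by
        obtain ⟨i, hi⟩ : (S A).1.Nonempty := Finset.card_pos.1 (by rw [(S A).2]; omega)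
        obtain ⟨j, hj⟩ : A.1.Nonempty := Finset.card_pos.1 (by rw [(hmem A).2]; omega)
        exact hinfo q (S A) i hi _ (TopKChoice.sum_menuDiv_lower_le hδ hδv hm hmn (S A) rfl
          (hmem A).1 (hmem A).2 hi (j := j) (by simp [hS, hj])))
      (fun T => by
        obtain ⟨T', hT'G, hT'q, hT'⟩ := exists_core_of_card_eq G T.1ᶜ q (by
          rw [Finset.card_compl, Fintype.card_fin, T.2, hGc])
        refine ⟨T', hT'G, hT'q, fun A => (hT' A.1 (hmem A).1).trans (le_of_eq ?_)⟩
        rw [TopKChoice.editDist]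
        congr 1
        ext x
        simp only [hS, Finset.mem_sdiff, Finset.mem_union, Finset.mem_compl]
        tauto)
    exact ⟨S A, TopKChoice.twoLevel_isTop hδ hδv _, hA⟩
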